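/- Let $M$ be a smooth manifold with a Riemannian metric $g_M$, and let $(\phi,\xi,\eta)$ be an almost contact metric structure on $(M,g_M)$: a $(1,1)$-tensor field $\phi$, a vector field $\xi$ and a one-form $\eta$, all smooth, such that $\phi^2=-I+\eta\otimes\xi$, $\phi\xi=0$, $\eta\circ\phi=0$, $\eta(\xi)=1$, $g_M(\phi X,\phi Y)=g_M(X,Y)-\eta(X)\eta(Y)$ and $\eta(X)=g_M(X,\xi)$. Suppose that this structure is cosymplectic, that is, it is normal ($[\phi,\phi]+2\,d\eta\otimes\xi=0$, where $[\phi,\phi]$ is the Nijenhuis tensor of $\phi$) and both $\eta$ and the fundamental two-form $\Phi(X,Y)=g_M(X,\phi Y)$ are closed. Let $(N,g_N)$ be a Riemannian manifold and let $F:M\to N$ be a Riemannian submersion, that is, a smooth surjective map whose differential $F_*$ has maximal rank (is surjective) at every point and preserves the lengths of horizontal vectors, i.e. of vectors in $(\ker F_*)^\perp$. Suppose that $F$ is anti-invariant, i.e. $\phi(\ker F_*)\subseteq(\ker F_*)^{\perp}$, and that $$(\ker F_*)^{\perp}=\phi(\ker F_*)\oplus\langle\xi\rangle .$$ Let $\nabla$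 be the Levi-Civita connection of $g_M$, let $\mathcal V$ and $\mathcal H$ be the orthogonal projections of $TM$ onto $\ker F_*$ and $(\ker F_*)^\perp$, and for vector fields $X,Y$ on $M$ let $$\mathcal T_XY=\mathcal H\nabla_{\mathcal VX}\mathcal VY+\mathcal V\nabla_{\mathcal VX}\mathcal HY,\qquad \mathcal A_XY=\mathcal V\nabla_{\mathcal HX}\mathcal HY+\mathcal H\nabla_{\mathcal HX}\mathcal VY$$ be O'Neill's tensors. Let $(\nabla F_*)(X,Y)=\nabla^F_X(F_*Y)-F_*(\nabla_XY)$ be the second fundamental form of $F$, where $\nabla^F$ is the pullback to $F^{-1}TN$ of the Levi-Civita connection of $g_N$. Then $F$ is a totally geodesic map, i.e. $\nabla F_*=0$, if and only if $$\mathcal T_W\phi V=0\ \text{ for all } V,W\in\Gamma(\ker F_*)\quad\text{and}\quad \mathcal A_X\phi W=0\ \text{ for all } X\in\Gamma((\ker F_*)^{\perp}),\ W\in\Gamma(\ker F_*),$$ where $\Gamma$ denotes smooth sections. -/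

import Mathlib

open scoped Manifold ContDiff Bundle
open Bundle

noncomputable section

namespace CosymplecticSubmersion

section LeviCivita

variable {E : Type*} [NormedAddCommGroup E] [NormedSpace ℝ E] [FiniteDimensional ℝ E]
  {H : Type*} [TopologicalSpace H] {I : ModelWithCorners ℝ E H}
  {M : Type*} [TopologicalSpace M] [ChartedSpace H M] [IsManifold I ∞ M]
  [RiemannianBundle (fun x : M => TangentSpace I x)]
  [IsContMDiffRiemannianBundle I ∞ E (fun x : M => TangentSpace I x)]

instance finiteDimensional_tangentSpace (x : M) : FiniteDimensional ℝ (TangentSpace I x) :=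
  inferInstanceAs (FiniteDimensional ℝ E)

instance completeSpace_tangentSpace (x : M) : CompleteSpace (TangentSpace I x) :=
  FiniteDimensional.complete ℝ _

/-- The function `g(X, Y)`. -/
def ip (X Y : Π x : M, TangentSpace I x) : M → ℝ := fun x => inner ℝ (X x) (Y x)

/-- The right-hand side of Koszul's formula for `g(∇_X Y, Z)`. -/
def koszul (Y X Z : Π x : M, TangentSpace I x) (x : M) : ℝ :=
  (1 / 2 : ℝ) * (d% (ip Y Z) x (X x) + d% (ip X Z) x (Y x) - d% (ip X Y) x (Z x)
    + inner ℝ (VectorField.mlieBracket I X Y x) (Z x)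
    - inner ℝ (VectorField.mlieBracket I X Z x) (Y x)
    - inner ℝ (VectorField.mlieBracket I Y Z x) (X x))

variable {X X' Y Y' Z Z' : Π x : M, TangentSpace I x} {f : M → ℝ} {x : M}

lemma mdiff_ip (hX : MDiffAt (T% X) x) (hY : MDiffAt (T% Y) x) : MDiffAt (ip X Y) x :=
  MDifferentiableAt.inner_bundle (E := fun x : M => TangentSpace I x) (b := id) hX hY

lemma ip_comm : ip X Y = ip Y X := by
  funext x; exact real_inner_comm _ _

lemma d_ip_add_left (hX : MDiffAt (T% X) x) (hX' : MDiffAt (T% X') x) (hY : MDiffAt (T% Y) x)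
    (v : TangentSpace I x) :
    d% (ip (X + X') Y) x v = d% (ip X Y) x v + d% (ip X' Y) x v := by
  have : ip (X + X') Y = ip X Y + ip X' Y := by
    funext y; simp [ip, inner_add_left]
  rw [this, mvfderiv_add (mdiff_ip hX hY) (mdiff_ip hX' hY)]
  rfl

lemma d_ip_smul_left (hf : MDiffAt f x) (hX : MDiffAt (T% X) x) (hY : MDiffAt (T% Y) x)
    (v : TangentSpace I x) :
    d% (ip (f • X) Y) x v = f x * d% (ip X Y) x v + ip X Y x * d% f x v := by
  have : ip (f • X) Y = f * ip X Y := by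
    funext y; simp [ip, inner_smul_left]
  rw [this, mvfderiv_mul hf (mdiff_ip hX hY)]
  simp

lemma d_ip_add_right (hX : MDiffAt (T% X) x) (hX' : MDiffAt (T% X') x) (hY : MDiffAt (T% Y) x)
    (v : TangentSpace I x) :
    d% (ip Y (X + X')) x v = d% (ip Y X) x v + d% (ip Y X') x v := by
  rw [ip_comm, d_ip_add_left hX hX' hY, ip_comm (X := X), ip_comm (X := X')]

lemma d_ip_smul_right (hf : MDiffAt f x) (hX : MDiffAt (T% X) x) (hY : MDiffAt (T% Y) x)
    (v : TangentSpace I x) :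
    d% (ip Y (f • X)) x v = f x * d% (ip Y X) x v + ip Y X x * d% f x v := by
  rw [ip_comm, d_ip_smul_left hf hX hY, ip_comm (X := X)]

open VectorField in
lemma koszul_tensorial_left (hY : MDiffAt (T% Y) x) (hZ : MDiffAt (T% Z) x) :
    TensorialAt I E (koszul Y · Z x) x where
  smul {f X} hf hX := by
    simp only [koszul, d_ip_smul_left hf hX hZ, d_ip_smul_left hf hX hY,
      mlieBracket_smul_left hf hX, Pi.smul_apply', map_smul, inner_add_left, inner_smul_left,
      inner_smul_right, smul_eq_mul, ip, RCLike.conj_to_real]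
    ring
  add hX hX' := by
    simp only [koszul, d_ip_add_left hX hX' hZ, d_ip_add_left hX hX' hY,
      mlieBracket_add_left hX hX', Pi.add_apply, map_add, inner_add_left,
      inner_add_right]
    ring


open VectorField in
lemma koszul_tensorial_right (hY : MDiffAt (T% Y) x) (hX : MDiffAt (T% X) x) :
    TensorialAt I E (koszul Y X · x) x where
  smul {f Z} hf hZ := by
    simp only [koszul, d_ip_smul_right hf hZ hY, d_ip_smul_right hf hZ hX,
      mlieBracket_smul_right hf hZ, Pi.smul_apply', map_smul, inner_add_left, inner_smul_left,
      inner_smul_right, smul_eq_mul, ip, RCLike.conj_to_real]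
    rw [real_inner_comm (Z x) (X x), real_inner_comm (Z x) (Y x)]
    ring
  add hZ hZ' := by
    simp only [koszul, d_ip_add_right hZ hZ' hY, d_ip_add_right hZ hZ' hX,
      mlieBracket_add_right hZ hZ', Pi.add_apply, map_add, inner_add_left,
      inner_add_right]
    ring

open scoped Classical in
/-- The Levi-Civita derivative `X ↦ ∇_X Y` of the vector field `Y` at the point `x`: the linear map
that Koszul's formula determines if `Y` is differentiable at `x`, and the junk value `0` if not. -/
def leviCivitaFun (Y : Π x : M, TangentSpace I x) (x : M) :
    TangentSpace I x →L[ℝ] TangentSpace I x :=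
  if hY : MDiffAt (T% Y) x then
    let B : TangentSpace I x →L[ℝ] TangentSpace I x →L[ℝ] ℝ :=
      TensorialAt.mkHom₂ (I := I) (F := E) (F' := E) (fun X Z => koszul Y X Z x) x
        (fun _ hZ => koszul_tensorial_left hY hZ) (fun _ hX => koszul_tensorial_right hY hX)
    LinearMap.toContinuousLinearMap
      { toFun := fun v => (InnerProductSpace.toDual ℝ (TangentSpace I x)).symm (B v)
        map_add' := fun v w => by simp
        map_smul' := fun c v => by simp }
  else 0

lemma inner_leviCivitaFun (hX : MDiffAt (T% X) x) (hY : MDiffAt (T% Y) x) (hZ : MDiffAt (T% Z) x) :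
    inner ℝ (leviCivitaFun Y x (X x)) (Z x) = koszul Y X Z x := by
  rw [leviCivitaFun, dif_pos hY]
  have := TensorialAt.mkHom₂_apply (I := I) (F := E) (F' := E) (Φ := fun X Z => koszul Y X Z x) 
        (fun _ hZ => koszul_tensorial_left hY hZ) (fun _ hX => koszul_tensorial_right hY hX) hX hZ
  rw [← this]
  exact InnerProductSpace.toDual_symm_apply (𝕜 := ℝ) (E := TangentSpace I x)

lemma ext_extend {A B : TangentSpace I x →L[ℝ] TangentSpace I x}
    (h : ∀ X Z : Π x : M, TangentSpace I x, MDiffAt (T% X) x → MDiffAt (T% Z) x →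
      inner ℝ (A (X x)) (Z x) = inner ℝ (B (X x)) (Z x)) : A = B := by
  ext1 v
  refine ext_inner_right ℝ fun w => ?_
  simpa using h (FiberBundle.extend E v) (FiberBundle.extend E w)
    (FiberBundle.mdifferentiableAt_extend ..) (FiberBundle.mdifferentiableAt_extend ..)

variable (I M) in
/-- The Levi-Civita connection of a Riemannian manifold; `leviCivita I M Y x (X x)` is the value of
`∇_X Y` at `x`. -/
def leviCivita : CovariantDerivative I E (TangentSpace I : M → Type _) where
  toFun := leviCivitaFun
  isCovariantDerivativeOnUniv :=
    { add := by
        intro Y Y' x hY hY' _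
        refine ext_extend fun X Z hX hZ => ?_
        rw [inner_leviCivitaFun hX (mdifferentiableAt_add_section hY hY') hZ,
          add_apply, inner_add_left, inner_leviCivitaFun hX hY hZ,
          inner_leviCivitaFun hX hY' hZ]
        simp only [koszul, d_ip_add_left hY hY' hZ, d_ip_add_right hY hY' hX,
          VectorField.mlieBracket_add_left hY hY', VectorField.mlieBracket_add_right hY hY',
          Pi.add_apply, map_add, inner_add_left, inner_add_right]
        ring
      leibniz := by
        intro Y f x hY hf _
        refine ext_extend fun X Z hX hZ => ?_
        rw [inner_leviCivitaFun hX (hf.smul_section hY) hZ]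
        simp only [add_apply, smul_apply,
          ContinuousLinearMap.smulRight_apply, inner_add_left, inner_smul_left,
          RCLike.conj_to_real, inner_leviCivitaFun hX hY hZ]
        simp only [koszul, d_ip_smul_left hf hY hZ, d_ip_smul_right hf hY hX,
          VectorField.mlieBracket_smul_left hf hY, VectorField.mlieBracket_smul_right hf hY,
          Pi.smul_apply', map_smul, inner_add_left, inner_smul_left, inner_smul_right, smul_eq_mul,
          ip, RCLike.conj_to_real]
        rw [real_inner_comm (X x) (Y x)]
        ring }

/-- The Levi-Civita connection is compatible with the metric. -/
theorem leviCivita_metric (hX : MDiffAt (T% X) x) (hY : MDiffAt (T% Y) x)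
    (hZ : MDiffAt (T% Z) x) :
    d% (fun y => inner ℝ (Y y) (Z y)) x (X x) =
      inner ℝ (leviCivita I M Y x (X x)) (Z x) + inner ℝ (Y x) (leviCivita I M Z x (X x)) := by
  change d% (ip Y Z) x (X x) = inner ℝ (leviCivitaFun Y x (X x)) (Z x) +
    inner ℝ (Y x) (leviCivitaFun Z x (X x))
  rw [real_inner_comm _ (Y x), inner_leviCivitaFun hX hY hZ, inner_leviCivitaFun hX hZ hY]
  simp only [koszul]
  rw [ip_comm (X := Z) (Y := Y), VectorField.mlieBracket_swap_apply (V := Z) (W := Y)]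
  simp only [inner_neg_left]
  ring

/-- The Levi-Civita connection is torsion-free. -/
theorem leviCivita_torsion (hX : MDiffAt (T% X) x) (hY : MDiffAt (T% Y) x) :
    leviCivita I M Y x (X x) - leviCivita I M X x (Y x) = VectorField.mlieBracket I X Y x := by
  change leviCivitaFun Y x (X x) - leviCivitaFun X x (Y x) = _
  refine ext_inner_right ℝ fun w => ?_
  have hZ := FiberBundle.mdifferentiableAt_extend I E (V := (TangentSpace I : M → Type _)) w
  have key := fun (Y X : Π x : M, TangentSpace I x) hX hY =>
    inner_leviCivitaFun (x := x) (X := X) (Y := Y) hX hY hZ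
  simp only [FiberBundle.extend_apply_self] at key
  rw [inner_sub_left, key _ _ hX hY, key _ _ hY hX]
  simp only [koszul]
  rw [ip_comm (X := Y) (Y := X), VectorField.mlieBracket_swap_apply (V := Y) (W := X)]
  simp only [inner_neg_left, FiberBundle.extend_apply_self]
  ring

end LeviCivita

section PullbackConnection

variable {E : Type*} [NormedAddCommGroup E] [NormedSpace ℝ E]
  {H : Type*} [TopologicalSpace H] {I : ModelWithCorners ℝ E H}
  {M : Type*} [TopologicalSpace M] [ChartedSpace H M]
  {E' : Type*} [NormedAddCommGroup E'] [NormedSpace ℝ E']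
  {H' : Type*} [TopologicalSpace H'] {J : ModelWithCorners ℝ E' H'}
  {N : Type*} [TopologicalSpace N] [ChartedSpace H' N] [IsManifold J ∞ N]

variable (I) in
/-- The pullback connection `∇^F` on the bundle `F⁻¹(TN)`, for a connection `cov` on `TN`.
A section of this bundle is a vector field `s` along `F`, and `pullbackCov I cov F s x v` is
`(∇^F_v s)(x)`. It is computed in the trivialization `e` of `TN` centred at `F x`: derivative of the
coordinates of `s`, plus the derivative in the direction `F_* v` of the vector field which is
constant in this trivialization and equal to `s x` at `F x`. -/
def pullbackCov (cov : CovariantDerivative J E' (TangentSpace J : N → Type _)) (F : M → N)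
    (s : Π x : M, TangentSpace J (F x)) (x : M) :
    TangentSpace I x →L[ℝ] TangentSpace J (F x) :=
  let e := trivializationAt E' (TangentSpace J : N → Type _) (F x)
  (e.symmL ℝ (F x)) ∘L (mvfderiv I (fun y => (e ⟨F y, s y⟩).2) x)
    + (cov (FiberBundle.extend E' (s x)) (F x)) ∘L (mfderiv I J F x)

variable {cov : CovariantDerivative J E' (TangentSpace J : N → Type _)} {F : M → N}

lemma cov_sum {ι : Type*} (t : Finset ι) {f : ι → N → ℝ} {σ : ι → Π q : N, TangentSpace J q}
    {q : N} (hf : ∀ i, MDiffAt (f i) q) (hσ : ∀ i, MDiffAt (T% (σ i)) q)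
    (v : TangentSpace J q) :
    MDiffAt (T% (∑ i ∈ t, f i • σ i)) q ∧ cov (∑ i ∈ t, f i • σ i) q v =
      ∑ i ∈ t, (f i q • cov (σ i) q v + d% (f i) q v • σ i q) := by
  classical
  induction t using Finset.induction_on with
  | empty =>
    refine ⟨by simpa [zeroSection] using! mdifferentiableAt_zeroSection ℝ (TangentSpace J : N → Type _), ?_⟩
    simp
  | insert i t hi ih =>
    rw [Finset.sum_insert hi, Finset.sum_insert hi]
    have h1 := (hf i).smul_section (hσ i)
    refine ⟨mdifferentiableAt_add_section h1 ih.1, ?_⟩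
    rw [cov.isCovariantDerivativeOnUniv.add h1 ih.1,
      cov.isCovariantDerivativeOnUniv.leibniz (hσ i) (hf i)]
    simp [ih.2]

/-- In the trivialization at `x`, the vector field `extend E' v` is constant. -/
lemma extend_eq {q₀ p : N} (v : TangentSpace J q₀)
    (hp : p ∈ (trivializationAt E' (TangentSpace J : N → Type _) q₀).baseSet) :
    FiberBundle.extend E' v p = (trivializationAt E' (TangentSpace J : N → Type _) q₀).symmL ℝ p
      ((trivializationAt E' (TangentSpace J : N → Type _) q₀) ⟨q₀, v⟩).2 := by
  rw [Trivialization.symmL_apply _ hp]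
  rfl

lemma cov_coord [FiniteDimensional ℝ E'] {Z : Π q : N, TangentSpace J q} {q : N}
    (hZ : MDiffAt (T% Z) q) (v : TangentSpace J q) :
    cov Z q v =
      (trivializationAt E' (TangentSpace J : N → Type _) q).symmL ℝ q
        (d% (fun p => (trivializationAt E' (TangentSpace J : N → Type _) q ⟨p, Z p⟩).2) q v) +
      cov (FiberBundle.extend E' (Z q)) q v := by
  classical
  let e := trivializationAt E' (TangentSpace J : N → Type _) q
  let b := Module.finBasis ℝ E'
  have hq : q ∈ e.baseSet := FiberBundle.mem_baseSet_trivializationAt' q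
  let ζ : N → E' := fun p => (e ⟨p, Z p⟩).2
  let l : Fin (Module.finrank ℝ E') → E' →L[ℝ] ℝ := fun i =>
    LinearMap.toContinuousLinearMap (b.coord i)
  have hl : ∀ w : E', ∑ i, l i w • b i = w := fun w => b.sum_repr w
  let σ : Fin (Module.finrank ℝ E') → Π p : N, TangentSpace J p := fun i =>
    FiberBundle.extend E' (e.symmL ℝ q (b i))
  have hσ : ∀ i, MDiffAt (T% (σ i)) q := fun i => FiberBundle.mdifferentiableAt_extend ..
  have hσ' : ∀ i, ∀ p ∈ e.baseSet, σ i p = e.symmL ℝ p (b i) := by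
    intro i p hp
    change FiberBundle.extend E' (e.symmL ℝ q (b i)) p = _
    rw [extend_eq _ hp, Trivialization.symmL_apply _ hq, e.apply_mk_symm hq]
  have hζ : MDiffAt ζ q := (mdifferentiableAt_section J (E := (TangentSpace J : N → Type _)) Z).1 hZ
  have hf : ∀ i, MDiffAt (fun p => l i (ζ p)) q := fun i =>
    (((l i).differentiableAt).mdifferentiableAt).comp q hζ
  have hdf : ∀ i, d% (fun p => l i (ζ p)) q v = l i (d% ζ q v) := by
    intro i
    have := mfderiv_comp q (((l i).differentiableAt (x := ζ q)).mdifferentiableAt) hζ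
    have h2 := congrArg (fun T => T v) this
    simp only [mfderiv_eq_fderiv, ContinuousLinearMap.fderiv] at h2
    exact h2
  have h1 := cov_sum (cov := cov) Finset.univ hf hσ v
  have h2 := cov_sum (cov := cov) Finset.univ
    (f := fun i _ => l i (ζ q)) (fun i => mdifferentiableAt_const) hσ v
  have e1 : ∀ᶠ p in nhds q, Z p = (∑ i, (fun p => l i (ζ p)) • σ i) p := by
    filter_upwards [e.open_baseSet.mem_nhds hq] with p hp
    simp only [Finset.sum_apply, Pi.smul_apply', hσ' _ p hp, ← map_smul, ← map_sum]
    rw [hl, Trivialization.symmL_apply _ hp, e.symm_apply_apply_mk hp]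
  have e2 : ∀ᶠ p in nhds q,
      FiberBundle.extend E' (Z q) p = (∑ i, (fun _ : N => l i (ζ q)) • σ i) p := by
    filter_upwards [e.open_baseSet.mem_nhds hq] with p hp
    simp only [Finset.sum_apply, Pi.smul_apply', hσ' _ p hp, ← map_smul, ← map_sum]
    rw [hl, extend_eq _ hp]
  rw [cov.isCovariantDerivativeOnUniv.congr_of_eventuallyEq hZ h1.1 Filter.univ_mem e1, h1.2,
    cov.isCovariantDerivativeOnUniv.congr_of_eventuallyEq
      (FiberBundle.mdifferentiableAt_extend ..) h2.1 Filter.univ_mem e2, h2.2]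
  have e4 : ∑ i, l i (d% ζ q v) • σ i q = e.symmL ℝ q (d% ζ q v) := by
    simp only [hσ' _ q hq, ← map_smul, ← map_sum, hl]
  simp only [hdf, mvfderiv_const, zero_apply, zero_smul, add_zero, Finset.sum_add_distrib, e4]
  rw [add_comm]

/-- The pullback connection satisfies `∇^F_v (Z ∘ F) = ∇_{F_* v} Z`. -/
theorem pullbackCov_comp [FiniteDimensional ℝ E'] {Z : Π q : N, TangentSpace J q} {x : M}
    (hF : MDiffAt F x) (hZ : MDiffAt (T% Z) (F x)) (v : TangentSpace I x) :
    pullbackCov I cov F (fun y => Z (F y)) x v = cov Z (F x) (mfderiv I J F x v) := by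
  rw [cov_coord hZ]
  have hζ := (mdifferentiableAt_section J (E := (TangentSpace J : N → Type _)) Z).1 hZ
  have := congrArg (fun T => T v) (mfderiv_comp x hζ hF)
  simp only [pullbackCov, add_apply, ContinuousLinearMap.comp_apply]
  congr 2

lemma mdiff_coord {s : Π x : M, TangentSpace J (F x)} {x : M}
    (hs : MDifferentiableAt I J.tangent (fun y => (⟨F y, s y⟩ : TangentBundle J N)) x) :
    MDiffAt F x ∧
      MDiffAt (fun y => (trivializationAt E' (TangentSpace J : N → Type _) (F x) ⟨F y, s y⟩).2) x :=
  (mdifferentiableAt_totalSpace J (E := (TangentSpace J : N → Type _)) _).1 hs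

/-- The pullback connection is additive. -/
theorem pullbackCov_add {s t : Π x : M, TangentSpace J (F x)} {x : M}
    (hs : MDifferentiableAt I J.tangent (fun y => (⟨F y, s y⟩ : TangentBundle J N)) x)
    (ht : MDifferentiableAt I J.tangent (fun y => (⟨F y, t y⟩ : TangentBundle J N)) x) :
    pullbackCov I cov F (fun y => s y + t y) x =
      pullbackCov I cov F s x + pullbackCov I cov F t x := by
  obtain ⟨hF, hs⟩ := mdiff_coord hs
  have ht := (mdiff_coord ht).2
  let e := trivializationAt E' (TangentSpace J : N → Type _) (F x)
  have hx : F x ∈ e.baseSet := FiberBundle.mem_baseSet_trivializationAt' (F x)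
  have e1 : (fun y => (e ⟨F y, s y + t y⟩).2) =ᶠ[nhds x]
      (fun y => (e ⟨F y, s y⟩).2) + (fun y => (e ⟨F y, t y⟩).2) := by
    filter_upwards [hF.continuousAt (e.open_baseSet.mem_nhds hx)] with y hy
    exact (e.linear ℝ hy).map_add _ _
  have e2 : ∀ᶠ p in nhds (F x), FiberBundle.extend E' (s x + t x) p =
      (FiberBundle.extend E' (s x) + FiberBundle.extend E' (t x)) p := by
    filter_upwards [e.open_baseSet.mem_nhds hx] with p hp
    rw [Pi.add_apply, extend_eq _ hp, extend_eq _ hp, extend_eq _ hp, (e.linear ℝ hx).map_add,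
      map_add]
  have e3 : mvfderiv I (fun y => (e ⟨F y, s y + t y⟩).2) x =
      mvfderiv I (fun y => (e ⟨F y, s y⟩).2) x + mvfderiv I (fun y => (e ⟨F y, t y⟩).2) x := by
    rw [← mvfderiv_add hs ht]
    exact e1.mfderiv_eq
  simp only [pullbackCov]
  rw [cov.isCovariantDerivativeOnUniv.congr_of_eventuallyEq
    (FiberBundle.mdifferentiableAt_extend ..)
    (mdifferentiableAt_add_section (FiberBundle.mdifferentiableAt_extend ..)
      (FiberBundle.mdifferentiableAt_extend ..)) Filter.univ_mem e2,
    cov.isCovariantDerivativeOnUniv.add (FiberBundle.mdifferentiableAt_extend ..)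
    (FiberBundle.mdifferentiableAt_extend ..), e3]
  simp only [ContinuousLinearMap.comp_add, ContinuousLinearMap.add_comp]
  abel

/-- The pullback connection satisfies the Leibniz rule. -/
theorem pullbackCov_smul {s : Π x : M, TangentSpace J (F x)} {f : M → ℝ} {x : M}
    (hf : MDiffAt f x)
    (hs : MDifferentiableAt I J.tangent (fun y => (⟨F y, s y⟩ : TangentBundle J N)) x)
    (v : TangentSpace I x) :
    pullbackCov I cov F (fun y => f y • s y) x v =
      f x • pullbackCov I cov F s x v + d% f x v • s x := by
  obtain ⟨hF, hs⟩ := mdiff_coord hs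
  let e := trivializationAt E' (TangentSpace J : N → Type _) (F x)
  have hx : F x ∈ e.baseSet := FiberBundle.mem_baseSet_trivializationAt' (F x)
  have e1 : (fun y => (e ⟨F y, f y • s y⟩).2) =ᶠ[nhds x] f • (fun y => (e ⟨F y, s y⟩).2) := by
    filter_upwards [hF.continuousAt (e.open_baseSet.mem_nhds hx)] with y hy
    exact (e.linear ℝ hy).map_smul _ _
  have e2 : ∀ᶠ p in nhds (F x), FiberBundle.extend E' (f x • s x) p =
      ((fun _ : N => f x) • FiberBundle.extend E' (s x)) p := by
    filter_upwards [e.open_baseSet.mem_nhds hx] with p hp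
    rw [Pi.smul_apply', extend_eq _ hp, extend_eq _ hp, (e.linear ℝ hx).map_smul, map_smul]
  have e3 : mvfderiv I (fun y => (e ⟨F y, f y • s y⟩).2) x v =
      f x • mvfderiv I (fun y => (e ⟨F y, s y⟩).2) x v
        + mvfderiv I f x v • (e ⟨F x, s x⟩).2 := by
    have h := mvfderiv_smul hf hs
    have h' : mvfderiv I (fun y => (e ⟨F y, f y • s y⟩).2) x =
      mvfderiv I (f • (fun y => (e ⟨F y, s y⟩).2)) x := e1.mfderiv_eq
    rw [h', h]
    simp [e]
  simp only [pullbackCov, add_apply, ContinuousLinearMap.comp_apply]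
  rw [cov.isCovariantDerivativeOnUniv.congr_of_eventuallyEq
    (FiberBundle.mdifferentiableAt_extend ..)
    (mdifferentiableAt_const.smul_section (FiberBundle.mdifferentiableAt_extend ..))
    Filter.univ_mem e2, cov.isCovariantDerivativeOnUniv.leibniz (FiberBundle.mdifferentiableAt_extend ..)
    mdifferentiableAt_const, e3]
  have e4 : e.symmL ℝ (F x) (e ⟨F x, s x⟩).2 = s x := by
    rw [Trivialization.symmL_apply _ hx, e.symm_apply_apply_mk hx]
  change e.symmL ℝ (F x) _ + _ = _ • (e.symmL ℝ (F x) _ + _) + _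
  simp only [map_add, map_smul, e4, mvfderiv_const, add_apply, smul_apply,
    ContinuousLinearMap.smulRight_apply, zero_apply, zero_smul, add_zero, smul_add]
  abel

end PullbackConnection

section AlmostContact

variable {E : Type*} [NormedAddCommGroup E] [NormedSpace ℝ E]
  {H : Type*} [TopologicalSpace H] {I : ModelWithCorners ℝ E H}
  {M : Type*} [TopologicalSpace M] [ChartedSpace H M] [IsManifold I ∞ M]

/-- The exterior derivative of a one-form, evaluated on two vector fields:
`2 dη(X, Y) = X η(Y) - Y η(X) - η([X, Y])`. -/
def extDerivOne (η : Π x : M, TangentSpace I x →L[ℝ] ℝ) (X Y : Π x : M, TangentSpace I x)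
    (x : M) : ℝ :=
  (1 / 2 : ℝ) * (d% (fun y => η y (Y y)) x (X x) - d% (fun y => η y (X y)) x (Y x)
    - η x (VectorField.mlieBracket I X Y x))

/-- The exterior derivative of a two-form, evaluated on three vector fields:
`3 dΦ(X, Y, Z)` is the cyclic sum of `X Φ(Y, Z) - Φ([X, Y], Z)`. -/
def extDerivTwo (Φ : Π x : M, TangentSpace I x → TangentSpace I x → ℝ)
    (X Y Z : Π x : M, TangentSpace I x) (x : M) : ℝ :=
  (1 / 3 : ℝ) * (d% (fun y => Φ y (Y y) (Z y)) x (X x) + d% (fun y => Φ y (Z y) (X y)) x (Y x)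
    + d% (fun y => Φ y (X y) (Y y)) x (Z x)
    - Φ x (VectorField.mlieBracket I X Y x) (Z x) - Φ x (VectorField.mlieBracket I Y Z x) (X x)
    - Φ x (VectorField.mlieBracket I Z X x) (Y x))

/-- The Nijenhuis tensor `[φ, φ](X, Y) = φ²[X, Y] + [φX, φY] - φ[φX, Y] - φ[X, φY]`. -/
def nijenhuis (φ : Π x : M, TangentSpace I x →L[ℝ] TangentSpace I x)
    (X Y : Π x : M, TangentSpace I x) (x : M) : TangentSpace I x :=
  φ x (φ x (VectorField.mlieBracket I X Y x))
    + VectorField.mlieBracket I (fun y => φ y (X y)) (fun y => φ y (Y y)) x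
    - φ x (VectorField.mlieBracket I (fun y => φ y (X y)) Y x)
    - φ x (VectorField.mlieBracket I X (fun y => φ y (Y y)) x)

variable [RiemannianBundle (fun x : M => TangentSpace I x)]

variable (I M) in
/-- An almost contact metric structure `(φ, ξ, η)` on the Riemannian manifold `M`. -/
structure AlmostContactMetricStructure where
  /-- the tensor field `φ` of type `(1, 1)` -/
  phi : Π x : M, TangentSpace I x →L[ℝ] TangentSpace I x
  /-- the characteristic vector field -/
  xi : Π x : M, TangentSpace I x
  /-- the one-form `η` -/
  eta : Π x : M, TangentSpace I x →L[ℝ] ℝ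
  contMDiff_phi : ContMDiff I (I.prod 𝓘(ℝ, E →L[ℝ] E)) ∞
    (fun x => TotalSpace.mk' (E →L[ℝ] E)
      (E := fun x : M => TangentSpace I x →L[ℝ] TangentSpace I x) x (phi x))
  contMDiff_xi : ContMDiff I I.tangent ∞ (T% xi)
  contMDiff_eta : ContMDiff I (I.prod 𝓘(ℝ, E →L[ℝ] ℝ)) ∞
    (fun x => TotalSpace.mk' (E →L[ℝ] ℝ)
      (E := fun x : M => TangentSpace I x →L[ℝ] Bundle.Trivial M ℝ x) x (eta x))
  phi_phi : ∀ (x : M) (v : TangentSpace I x), phi x (phi x v) = -v + eta x v • xi x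
  phi_xi : ∀ x : M, phi x (xi x) = 0
  eta_phi : ∀ (x : M) (v : TangentSpace I x), eta x (phi x v) = 0
  eta_xi : ∀ x : M, eta x (xi x) = 1
  inner_phi_phi : ∀ (x : M) (v w : TangentSpace I x),
    inner ℝ (phi x v) (phi x w) = inner ℝ v w - eta x v * eta x w
  eta_eq_inner : ∀ (x : M) (v : TangentSpace I x), eta x v = inner ℝ v (xi x)

namespace AlmostContactMetricStructure

/-- The fundamental two-form `Φ(v, w) = g(v, φ w)`. -/
def fundamentalForm (S : AlmostContactMetricStructure I M) (x : M) (v w : TangentSpace I x) : ℝ :=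
  inner ℝ v (S.phi x w)

/-- The structure is cosymplectic: it is normal, and both `η` and `Φ` are closed. -/
structure IsCosymplectic (S : AlmostContactMetricStructure I M) : Prop where
  normal : ∀ X Y : Π x : M, TangentSpace I x,
    ContMDiff I I.tangent ∞ (T% X) → ContMDiff I I.tangent ∞ (T% Y) → ∀ x : M,
    nijenhuis S.phi X Y x + (2 * extDerivOne S.eta X Y x) • S.xi x = 0
  closed_eta : ∀ X Y : Π x : M, TangentSpace I x,
    ContMDiff I I.tangent ∞ (T% X) → ContMDiff I I.tangent ∞ (T% Y) → ∀ x : M,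
    extDerivOne S.eta X Y x = 0
  closed_fundamentalForm : ∀ X Y Z : Π x : M, TangentSpace I x,
    ContMDiff I I.tangent ∞ (T% X) → ContMDiff I I.tangent ∞ (T% Y) →
    ContMDiff I I.tangent ∞ (T% Z) → ∀ x : M,
    extDerivTwo S.fundamentalForm X Y Z x = 0

end AlmostContactMetricStructure

end AlmostContact

section Submersion

variable {E : Type*} [NormedAddCommGroup E] [NormedSpace ℝ E] [FiniteDimensional ℝ E]
  {H : Type*} [TopologicalSpace H] (I : ModelWithCorners ℝ E H)
  {M : Type*} [TopologicalSpace M] [ChartedSpace H M] [IsManifold I ∞ M]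
  [RiemannianBundle (fun x : M => TangentSpace I x)]
  [IsContMDiffRiemannianBundle I ∞ E (fun x : M => TangentSpace I x)]
  {E' : Type*} [NormedAddCommGroup E'] [NormedSpace ℝ E'] [FiniteDimensional ℝ E']
  {H' : Type*} [TopologicalSpace H'] (J : ModelWithCorners ℝ E' H')
  {N : Type*} [TopologicalSpace N] [ChartedSpace H' N] [IsManifold J ∞ N]
  [RiemannianBundle (fun q : N => TangentSpace J q)]
  [IsContMDiffRiemannianBundle J ∞ E' (fun q : N => TangentSpace J q)]

/-- The vertical space `ker F_*` at `x`. The horizontal space is `(vertical I J F x)ᗮ`. -/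
def vertical (F : M → N) (x : M) : Submodule ℝ (TangentSpace I x) :=
  LinearMap.ker (mfderiv I J F x : TangentSpace I x →ₗ[ℝ] TangentSpace J (F x))

/-- The vertical part of a vector field. -/
def verPart (F : M → N) (X : Π x : M, TangentSpace I x) (x : M) : TangentSpace I x :=
  (vertical I J F x).starProjection (X x)

/-- The horizontal part of a vector field. -/
def horPart (F : M → N) (X : Π x : M, TangentSpace I x) (x : M) : TangentSpace I x :=
  (vertical I J F x)ᗮ.starProjection (X x)

/-- A smooth section of `ker F_*`. -/
def IsVerticalField (F : M → N) (V : Π x : M, TangentSpace I x) : Prop :=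
  ContMDiff I I.tangent ∞ (T% V) ∧ ∀ x, V x ∈ vertical I J F x

/-- A smooth section of `(ker F_*)ᗮ`. -/
def IsHorizontalField (F : M → N) (X : Π x : M, TangentSpace I x) : Prop :=
  ContMDiff I I.tangent ∞ (T% X) ∧ ∀ x, X x ∈ (vertical I J F x)ᗮ

/-- The covariant derivative `∇_X Y` for the Levi-Civita connection of `M`. -/
def nabla (X Y : Π x : M, TangentSpace I x) (x : M) : TangentSpace I x :=
  leviCivita I M Y x (X x)

/-- O'Neill's tensor `T_X Y = H ∇_{V X} (V Y) + V ∇_{V X} (H Y)`. -/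
def tensorT (F : M → N) (X Y : Π x : M, TangentSpace I x) (x : M) : TangentSpace I x :=
  horPart I J F (nabla I (verPart I J F X) (verPart I J F Y)) x
    + verPart I J F (nabla I (verPart I J F X) (horPart I J F Y)) x

/-- O'Neill's tensor `A_X Y = V ∇_{H X} (H Y) + H ∇_{H X} (V Y)`. -/
def tensorA (F : M → N) (X Y : Π x : M, TangentSpace I x) (x : M) : TangentSpace I x :=
  verPart I J F (nabla I (horPart I J F X) (horPart I J F Y)) x
    + horPart I J F (nabla I (horPart I J F X) (verPart I J F Y)) x

/-- The second fundamental form `(∇F_*)(X, Y) = ∇^F_X (F_* Y) - F_* (∇_X Y)` of a map. -/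
def secondFundamentalForm (F : M → N) (X Y : Π x : M, TangentSpace I x) (x : M) :
    TangentSpace J (F x) :=
  pullbackCov I (leviCivita J N) F (fun y => mfderiv I J F y (Y y)) x (X x)
    - mfderiv I J F x (nabla I X Y x)

/-- `F` is a totally geodesic map: `∇F_* = 0`. -/
def IsTotallyGeodesic (F : M → N) : Prop :=
  ∀ X Y : Π x : M, TangentSpace I x,
    ContMDiff I I.tangent ∞ (T% X) → ContMDiff I I.tangent ∞ (T% Y) →
    ∀ x, secondFundamentalForm I J F X Y x = 0

/-- `F` is a Riemannian submersion: a smooth surjective map, of maximal rank, whose differential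
preserves the lengths of horizontal vectors. -/
structure IsRiemannianSubmersion (F : M → N) : Prop where
  contMDiff : ContMDiff I J ∞ F
  surjective : Function.Surjective F
  surjective_mfderiv : ∀ x : M, Function.Surjective (mfderiv I J F x)
  norm_mfderiv : ∀ (x : M), ∀ v ∈ (vertical I J F x)ᗮ, ‖mfderiv I J F x v‖ = ‖v‖

variable {I} in
/-- `F` is anti-invariant: `φ (ker F_*) ⊆ (ker F_*)ᗮ`. -/
def IsAntiInvariant (S : AlmostContactMetricStructure I M) (F : M → N) : Prop :=
  ∀ x : M, (vertical I J F x).map (S.phi x : TangentSpace I x →ₗ[ℝ] TangentSpace I x) ≤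
    (vertical I J F x)ᗮ

end Submersion

end CosymplecticSubmersion

end

open CosymplecticSubmersion

/-!
Write `B = ∇F_*`. Since both Levi-Civita connections are torsion-free, `B` is symmetric. As `F_*` is
isometric on horizontal fields and both connections are metric, `g_N (B(X, Y), F_* Z)` is
antisymmetric in the horizontal fields `Y, Z`; being also symmetric in `X, Y`, it vanishes. For `U`
vertical, `B(X, U) = -F_* (∇_X U)`. Hence `F` is totally geodesic if and only if `∇_X U` is vertical
for all vertical `U`, i.e. orthogonal to all `φ V` with `V` vertical and to `ξ`. If `ξ` is parallel,
then `g(∇_X U, ξ) = -g(U, ∇_X ξ) = 0`, while `g(∇_X U, φ V) = -g(U, ∇_X (φ V))` is controlled by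
the vertical part of `∇_X (φ V)`, which is `T_X φV` for `X` vertical and `A_X φV` for `X`
horizontal.

On a cosymplectic manifold `ξ` is parallel: `dη = 0` makes `∇ξ` self-adjoint, while normality gives
`L_ξ φ = 0`, so that `dΦ = 0` makes `g(∇_X ξ, φ Z)` antisymmetric under exchange of `X` and `φ Z`;
finally `g(∇_X ξ, ξ) = 0` because `ξ` has unit length.
-/

namespace CosymplecticSubmersion

theorem eq_sum_inner_smul_of_pairwise_orthogonal {W : Type*} [NormedAddCommGroup W]
    [InnerProductSpace ℝ W] {ι : Type*} [Fintype ι] {g : ι → W} (hg : ∀ i, g i ≠ 0)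
    (horth : Pairwise fun i j => inner ℝ (g i) (g j) = 0)
    (hspan : ⊤ ≤ Submodule.span ℝ (Set.range g)) (w : W) :
    w = ∑ i, (inner ℝ (g i) w * (inner ℝ (g i) (g i))⁻¹) • g i := by
  obtain ⟨c, rfl⟩ :=
    (Submodule.mem_span_range_iff_exists_fun ℝ).1 (hspan (Submodule.mem_top (x := w)))
  refine Finset.sum_congr rfl fun i _ => ?_
  rw [inner_sum, Finset.sum_eq_single i (fun j _ hj => by rw [inner_smul_right, horth hj.symm,
    mul_zero]) (by simp), inner_smul_right, mul_assoc,
    mul_inv_cancel₀ (inner_self_ne_zero.2 (hg i)), mul_one]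

section SmoothSections

variable {EB : Type*} [NormedAddCommGroup EB] [NormedSpace ℝ EB]
  {HB : Type*} [TopologicalSpace HB] {IB : ModelWithCorners ℝ EB HB} {n : ℕ∞ω}
  {B : Type*} [TopologicalSpace B] [ChartedSpace HB B]
  {F : Type*} [NormedAddCommGroup F] [NormedSpace ℝ F]
  {V : B → Type*} [TopologicalSpace (TotalSpace F V)]

theorem exists_contMDiff_section_eq [FiniteDimensional ℝ EB] [IsManifold IB ∞ B] [T2Space B]
    [∀ x, AddCommGroup (V x)] [∀ x, Module ℝ (V x)] [∀ x, TopologicalSpace (V x)]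
    [FiberBundle F V] [VectorBundle ℝ F V] [ContMDiffVectorBundle ∞ F V IB]
    (x : B) (v : V x) :
    ∃ s : Π x : B, V x, ContMDiff IB (IB.prod 𝓘(ℝ, F)) ∞ (T% s) ∧ s x = v := by
  obtain ⟨t, ht, h⟩ := FiberBundle.exists_contMDiffOn_extend (k := ∞) IB F v
  obtain ⟨f, -, hf⟩ :=
    (SmoothBumpFunction.nhds_basis_tsupport (I := IB) x).mem_iff.1 (interior_mem_nhds.2 ht)
  refine ⟨fun y => f y • FiberBundle.extend F v y, fun y => ?_, by simp⟩
  by_cases hy : y ∈ tsupport f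
  · exact f.contMDiffAt.smul_section (h.contMDiffAt (mem_interior_iff_mem_nhds.1 (hf hy)))
  · refine (contMDiffAt_zeroSection ℝ V).congr_of_eventuallyEq ?_
    filter_upwards [(isClosed_tsupport f).isOpen_compl.mem_nhds hy] with z hz
    simp [image_eq_zero_of_notMem_tsupport hz, zeroSection]

variable [∀ x, NormedAddCommGroup (V x)] [∀ x, InnerProductSpace ℝ (V x)]
  [FiberBundle F V] [VectorBundle ℝ F V] [IsContMDiffRiemannianBundle IB n F V]

open InnerProductSpace in
theorem contMDiffAt_gramSchmidt {ι : Type*} [LinearOrder ι] [LocallyFiniteOrderBot ι]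
    [WellFoundedLT ι] {s : ι → Π x : B, V x} {x : B}
    (hs : ∀ i, ContMDiffAt IB (IB.prod 𝓘(ℝ, F)) n (T% (s i)) x)
    (hli : LinearIndependent ℝ (fun i => s i x)) (i : ι) :
    ContMDiffAt IB (IB.prod 𝓘(ℝ, F)) n (T% (fun y => gramSchmidt ℝ (fun j => s j y) i)) x := by
  induction i using WellFoundedLT.induction with
  | ind i ih =>
    have gramSchmidt_eq (y : B) : gramSchmidt ℝ (fun j => s j y) i = s i y -
        ∑ j ∈ Finset.Iio i, (inner ℝ (gramSchmidt ℝ (fun j => s j y) j) (s i y) *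
          (inner ℝ (gramSchmidt ℝ (fun j => s j y) j) (gramSchmidt ℝ (fun j => s j y) j))⁻¹) •
          gramSchmidt ℝ (fun j => s j y) j := by
      rw [gramSchmidt_def]
      simp only [Submodule.starProjection_singleton, real_inner_self_eq_norm_sq, div_eq_mul_inv]
      rfl
    simp only [gramSchmidt_eq]
    refine (hs i).sub_section (ContMDiffAt.sum_section fun j hj => ?_)
    have hj := ih j (Finset.mem_Iio.1 hj)
    exact (((hj.inner_bundle (hs i)).mul ((hj.inner_bundle hj).inv₀
      (inner_self_ne_zero.2 (gramSchmidt_ne_zero j hli)))).smul_section hj)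

variable [FiniteDimensional ℝ F] [ContMDiffVectorBundle n F V IB]

variable (IB n F V) in
open InnerProductSpace in
theorem exists_contMDiffAt_orthogonal_frame (x : B) :
    ∃ s : Fin (Module.finrank ℝ F) → Π x : B, V x,
      (∀ i, ContMDiffAt IB (IB.prod 𝓘(ℝ, F)) n (T% (s i)) x) ∧ (∀ i, s i x ≠ 0) ∧
      ∀ᶠ y in nhds x, ∀ v : V y,
        v = ∑ i, (inner ℝ (s i y) v * (inner ℝ (s i y) (s i y))⁻¹) • s i y := by
  let e := trivializationAt F V x
  let b := Module.finBasis ℝ F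
  have hx : x ∈ e.baseSet := FiberBundle.mem_baseSet_trivializationAt' x
  have hb := e.isLocalFrameOn_localFrame_baseSet IB n b
  refine ⟨fun i y => gramSchmidt ℝ (fun j => e.localFrame b j y) i,
    contMDiffAt_gramSchmidt (fun i => hb.contMDiffAt e.open_baseSet hx i)
      (hb.linearIndependent hx), fun i => gramSchmidt_ne_zero i (hb.linearIndependent hx), ?_⟩
  filter_upwards [e.open_baseSet.mem_nhds hx] with y hy v
  refine eq_sum_inner_smul_of_pairwise_orthogonal
    (fun i => gramSchmidt_ne_zero i (hb.linearIndependent hy))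
    (gramSchmidt_pairwise_orthogonal ℝ _) ?_ v
  rw [span_gramSchmidt]
  exact hb.generating hy

theorem contMDiffAt_section_of_forall_inner {s : Π x : B, V x} {x : B}
    (hs : ∀ t : Π x : B, V x, ContMDiffAt IB (IB.prod 𝓘(ℝ, F)) n (T% t) x →
      ContMDiffAt IB 𝓘(ℝ, ℝ) n (fun y => inner ℝ (t y) (s y)) x) :
    ContMDiffAt IB (IB.prod 𝓘(ℝ, F)) n (T% s) x := by
  obtain ⟨e, he, hne, heq⟩ := exists_contMDiffAt_orthogonal_frame IB n F V x
  have hsum : ContMDiffAt IB (IB.prod 𝓘(ℝ, F)) n (T% (fun y =>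
      ∑ i, (inner ℝ (e i y) (s y) * (inner ℝ (e i y) (e i y))⁻¹) • e i y)) x :=
    ContMDiffAt.sum_section fun i _ => ((hs _ (he i)).mul (((he i).inner_bundle (he i)).inv₀
      (inner_self_ne_zero.2 (hne i)))).smul_section (he i)
  refine hsum.congr_of_eventuallyEq ?_
  filter_upwards [heq] with y hy
  exact congrArg (TotalSpace.mk y) (hy (s y))

end SmoothSections

section VerticalHorizontal

variable {E : Type*} [NormedAddCommGroup E] [NormedSpace ℝ E]
  {H : Type*} [TopologicalSpace H] {I : ModelWithCorners ℝ E H}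
  {M : Type*} [TopologicalSpace M] [ChartedSpace H M]
  {E' : Type*} [NormedAddCommGroup E'] [NormedSpace ℝ E']
  {H' : Type*} [TopologicalSpace H'] {J : ModelWithCorners ℝ E' H'}
  {N : Type*} [TopologicalSpace N] [ChartedSpace H' N]
  {F : M → N} {X : Π x : M, TangentSpace I x} {x : M}

lemma mem_vertical {v : TangentSpace I x} :
    v ∈ vertical I J F x ↔ mfderiv I J F x v = 0 := Iff.rfl

variable [FiniteDimensional ℝ E] [RiemannianBundle (fun x : M => TangentSpace I x)]

variable (X x) in
lemma verPart_add_horPart : verPart I J F X x + horPart I J F X x = X x :=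
  Submodule.starProjection_add_starProjection_orthogonal (K := vertical I J F x) (X x)

variable (X x) in
lemma verPart_mem : verPart I J F X x ∈ vertical I J F x :=
  Submodule.starProjection_apply_mem _ _

variable (X x) in
lemma horPart_mem : horPart I J F X x ∈ (vertical I J F x)ᗮ :=
  Submodule.starProjection_apply_mem _ _

variable (X x) in
lemma mfderiv_horPart : mfderiv I J F x (horPart I J F X x) = mfderiv I J F x (X x) := by
  conv_rhs => rw [← verPart_add_horPart (J := J) (F := F) X x]
  rw [map_add, mem_vertical.1 (verPart_mem X x), zero_add]

variable [RiemannianBundle (fun q : N => TangentSpace J q)]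

lemma IsRiemannianSubmersion.inner_mfderiv (hF : IsRiemannianSubmersion I J F)
    {v w : TangentSpace I x} (hv : v ∈ (vertical I J F x)ᗮ) :
    inner ℝ (mfderiv I J F x v) (mfderiv I J F x w) = inner ℝ v w := by
  have inner_horizontal (a : TangentSpace I x) (ha : a ∈ (vertical I J F x)ᗮ) :
      inner ℝ (mfderiv I J F x v) (mfderiv I J F x a) = inner ℝ v a := by
    rw [real_inner_eq_norm_add_mul_self_sub_norm_mul_self_sub_norm_mul_self_div_two,
      real_inner_eq_norm_add_mul_self_sub_norm_mul_self_sub_norm_mul_self_div_two,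
      ← map_add, hF.norm_mfderiv x v hv, hF.norm_mfderiv x a ha,
      hF.norm_mfderiv x _ (Submodule.add_mem _ hv ha)]
  obtain ⟨a, ha, b, hb, rfl⟩ := (vertical I J F x).exists_add_mem_mem_orthogonal w
  rw [map_add, mem_vertical.1 ha, zero_add, inner_add_right,
    (Submodule.mem_orthogonal' _ _).1 hv a ha, zero_add, inner_horizontal b hb]

variable [IsManifold I ∞ M] [IsManifold J ∞ N]
  [IsContMDiffRiemannianBundle I ∞ E (fun x : M => TangentSpace I x)]
  [IsContMDiffRiemannianBundle J ∞ E' (fun q : N => TangentSpace J q)]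

theorem IsRiemannianSubmersion.contMDiff_horPart (hF : IsRiemannianSubmersion I J F)
    (hX : ContMDiff I I.tangent ∞ (T% X)) :
    ContMDiff I I.tangent ∞ (T% (horPart I J F X)) := by
  refine fun x => contMDiffAt_section_of_forall_inner (V := fun x : M => TangentSpace I x)
    fun Z hZ => ?_
  have inner_horPart (y : M) : inner ℝ (Z y) (horPart I J F X y) =
      inner ℝ (mfderiv I J F y (Z y)) (mfderiv I J F y (X y)) := by
    rw [real_inner_comm, ← hF.inner_mfderiv (horPart_mem X y), mfderiv_horPart, real_inner_comm]
  have contMDiffAt_mfderiv {Y : Π x : M, TangentSpace I x}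
      (hY : ContMDiffAt I I.tangent ∞ (T% Y) x) :
      ContMDiffAt I J.tangent ∞ (fun y => (⟨F y, mfderiv I J F y (Y y)⟩ : TangentBundle J N)) x :=
    ((hF.contMDiff.contMDiff_tangentMap (m := ∞) (by simp)) _).comp x hY
  simp only [inner_horPart]
  exact ContMDiffAt.inner_bundle (E := fun q : N => TangentSpace J q) (b := F)
    (contMDiffAt_mfderiv hZ) (contMDiffAt_mfderiv (hX x))

theorem IsRiemannianSubmersion.contMDiff_verPart (hF : IsRiemannianSubmersion I J F)
    (hX : ContMDiff I I.tangent ∞ (T% X)) :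
    ContMDiff I I.tangent ∞ (T% (verPart I J F X)) := by
  have verPart_eq (y : M) : verPart I J F X y = X y - horPart I J F X y :=
    eq_sub_of_add_eq (verPart_add_horPart X y)
  simp only [verPart_eq]
  exact hX.sub_section (hF.contMDiff_horPart hX)

theorem IsRiemannianSubmersion.isVerticalField_verPart (hF : IsRiemannianSubmersion I J F)
    (hX : ContMDiff I I.tangent ∞ (T% X)) : IsVerticalField I J F (verPart I J F X) :=
  ⟨hF.contMDiff_verPart hX, fun y => verPart_mem X y⟩

theorem IsRiemannianSubmersion.isHorizontalField_horPart (hF : IsRiemannianSubmersion I J F)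
    (hX : ContMDiff I I.tangent ∞ (T% X)) : IsHorizontalField I J F (horPart I J F X) :=
  ⟨hF.contMDiff_horPart hX, fun y => horPart_mem X y⟩

theorem IsRiemannianSubmersion.exists_isVerticalField_eq [T2Space M]
    (hF : IsRiemannianSubmersion I J F) {v : TangentSpace I x} (hv : v ∈ vertical I J F x) :
    ∃ V, IsVerticalField I J F V ∧ V x = v := by
  obtain ⟨X, hX, rfl⟩ := exists_contMDiff_section_eq (IB := I) (F := E) x v
  exact ⟨verPart I J F X, hF.isVerticalField_verPart hX, Submodule.starProjection_eq_self_iff.2 hv⟩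

end VerticalHorizontal

section LieBracket

open VectorField Set

variable {E : Type*} [NormedAddCommGroup E] [NormedSpace ℝ E]
  {H : Type*} [TopologicalSpace H] {I : ModelWithCorners ℝ E H}
  {M : Type*} [TopologicalSpace M] [ChartedSpace H M] [IsManifold I 2 M]
  {G : Type*} [NormedAddCommGroup G] [NormedSpace ℝ G]
  {f : M → G} {x : M} {X Y : Π x : M, TangentSpace I x}

lemma fderivWithin_comp_extChartAt_symm_mpullbackWithin {z : E}
    (hz : z ∈ (extChartAt I x).target) (hf : MDiffAt f ((extChartAt I x).symm z)) :
    fderivWithin ℝ (f ∘ (extChartAt I x).symm) (range I) z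
        (mpullbackWithin 𝓘(ℝ, E) I (extChartAt I x).symm X (range I) z) =
      d% f ((extChartAt I x).symm z) (X ((extChartAt I x).symm z)) := by
  have hchain := mfderiv_comp_mfderivWithin z hf (mdifferentiableWithinAt_extChartAt_symm hz)
    (I.uniqueMDiffOn _ (extChartAt_target_subset_range x hz))
  rw [mfderivWithin_eq_fderivWithin] at hchain
  exact (congrArg (fun T : E →L[ℝ] G => T _) hchain).trans <| congrArg (d% f _) <|
    (isInvertible_mfderivWithin_extChartAt_symm hz).self_apply_inverse _

lemma mlieBracket_eq_lieBracketWithin :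
    mlieBracket I X Y x = lieBracketWithin ℝ
      (mpullbackWithin 𝓘(ℝ, E) I (extChartAt I x).symm X (range I))
      (mpullbackWithin 𝓘(ℝ, E) I (extChartAt I x).symm Y (range I))
      (range I) (extChartAt I x x) := by
  have hinv : (mfderiv I 𝓘(ℝ, E) (extChartAt I x) x).inverse = ContinuousLinearMap.id ℝ E :=
    (congrArg ContinuousLinearMap.inverse (mfderiv_extChartAt_self (I := I) (x := x))).trans
      ContinuousLinearMap.inverse_id
  rw [← mlieBracketWithin_univ, mlieBracketWithin_apply, preimage_univ, univ_inter]
  exact congrArg (fun T : E →L[ℝ] E => T _) hinv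

variable [CompleteSpace E]

lemma differentiableWithinAt_mpullbackWithin_extChartAt_symm (hX : MDiffAt (T% X) x) :
    DifferentiableWithinAt ℝ (mpullbackWithin 𝓘(ℝ, E) I (extChartAt I x).symm X (range I))
      (range I) (extChartAt I x x) := by
  simpa only [preimage_univ, univ_inter] using
    (mdifferentiableWithinAt_univ.2 hX).differentiableWithinAt_mpullbackWithin_vectorField

lemma mvfderiv_mvfderiv_apply (hf : ContMDiffAt I 𝓘(ℝ, G) 2 f x) (hY : MDiffAt (T% Y) x)
    (v : TangentSpace I x) :
    d% (fun y => d% f y (Y y)) x v =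
      fderivWithin ℝ (fun z => fderivWithin ℝ (f ∘ (extChartAt I x).symm) (range I) z
        (mpullbackWithin 𝓘(ℝ, E) I (extChartAt I x).symm Y (range I) z))
        (range I) (extChartAt I x x) v := by
  set φ := extChartAt I x
  let k : E → G := fun z => fderivWithin ℝ (f ∘ φ.symm) (range I) z
    (mpullbackWithin 𝓘(ℝ, E) I φ.symm Y (range I) z)
  have hk : DifferentiableWithinAt ℝ k (range I) (φ x) := by
    have hdf := ContDiffWithinAt.fderivWithin_right (m := 1) (contMDiffAt_iff.1 hf).2
      I.uniqueDiffOn le_rfl (mem_range_self _)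
    exact (hdf.differentiableWithinAt one_ne_zero).clm_apply
      (differentiableWithinAt_mpullbackWithin_extChartAt_symm hY)
  have heq : (fun y => d% f y (Y y)) =ᶠ[nhds x] k ∘ φ := by
    filter_upwards [extChartAt_source_mem_nhds (I := I) x,
      (contMDiffAt_iff_contMDiffAt_nhds (by simp)).1 hf] with y hy hfy
    have hinv : φ.symm (φ y) = y := φ.left_inv hy
    have hfy : MDiffAt f (φ.symm (φ y)) := hinv.symm ▸ hfy.mdifferentiableAt two_ne_zero
    exact ((fderivWithin_comp_extChartAt_symm_mpullbackWithin (φ.map_source hy) hfy).trans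
      (congrArg (fun y => d% f y (Y y)) hinv)).symm
  have hφ : HasMFDerivAt I 𝓘(ℝ, E) φ x (ContinuousLinearMap.id ℝ E) :=
    mfderiv_extChartAt_self (I := I) (x := x) ▸
      (mdifferentiableAt_extChartAt (mem_chart_source H x)).hasMFDerivAt
  have hcomp : HasMFDerivAt I 𝓘(ℝ, G) (k ∘ φ) x (fderivWithin ℝ k (range I) (φ x)) :=
    hasMFDerivWithinAt_univ.1 <| hk.hasFDerivWithinAt.hasMFDerivWithinAt.comp x
      hφ.hasMFDerivWithinAt fun y _ => mem_range_self _
  exact congrArg (fun T : E →L[ℝ] G => T v) (heq.mfderiv_eq.trans hcomp.mfderiv)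

theorem mvfderiv_mlieBracket (hf : ContMDiffAt I 𝓘(ℝ, G) 2 f x)
    (hX : MDiffAt (T% X) x) (hY : MDiffAt (T% Y) x) :
    d% f x (mlieBracket I X Y x) =
      d% (fun y => d% f y (Y y)) x (X x) - d% (fun y => d% f y (X y)) x (Y x) := by
  rw [mvfderiv_mvfderiv_apply hf hY, mvfderiv_mvfderiv_apply hf hX]
  have mpullback_self (Z : Π x : M, TangentSpace I x) :
      mpullbackWithin 𝓘(ℝ, E) I (extChartAt I x).symm Z (range I) (extChartAt I x x) = Z x := by
    rw [mpullbackWithin_apply, extChartAt_to_inv]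
    exact mfderivWithin_extChartAt_symm_inverse_apply (Z x)
  rw [← mpullback_self X, ← mpullback_self Y]
  refine Eq.trans ?_ <| fderivWithin_apply_lieBracket (contMDiffAt_iff.1 hf).2 (by simp)
    I.uniqueDiffOn (I.range_subset_closure_interior (mem_range_self _)) (mem_range_self _)
    (differentiableWithinAt_mpullbackWithin_extChartAt_symm hY)
    (differentiableWithinAt_mpullbackWithin_extChartAt_symm hX)
  rw [mlieBracket_eq_lieBracketWithin]
  exact congrArg (fun T : E →L[ℝ] G => T _) (hf.mdifferentiableAt two_ne_zero).mfderiv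

end LieBracket

section PullbackTorsion

open VectorField

variable {E' : Type*} [NormedAddCommGroup E'] [NormedSpace ℝ E']
  {H' : Type*} [TopologicalSpace H'] {J : ModelWithCorners ℝ E' H'}
  {N : Type*} [TopologicalSpace N] [ChartedSpace H' N] [IsManifold J ∞ N]

lemma trivializationAt_snd_eq_mvfderiv_extChartAt {q p : N} (hp : p ∈ (chartAt H' q).source)
    (w : TangentSpace J p) :
    (trivializationAt E' (TangentSpace J : N → Type _) q ⟨p, w⟩).2 = d% (extChartAt J q) p w := by
  have hp' : p ∈ (trivializationAt E' (TangentSpace J : N → Type _) q).baseSet := by simpa using hp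
  refine Eq.trans ?_ <| congrArg (fun T => T w) <|
    TangentBundle.continuousLinearMapAt_trivializationAt (I := J) hp
  rw [Trivialization.continuousLinearMapAt_apply, Trivialization.linearMapAt_apply, if_pos hp']

lemma symmL_mvfderiv_extChartAt {q : N} (v : TangentSpace J q) :
    (trivializationAt E' (TangentSpace J : N → Type _) q).symmL ℝ q (d% (extChartAt J q) q v) =
      v := by
  have hq := FiberBundle.mem_baseSet_trivializationAt E' (TangentSpace J : N → Type _) q
  rw [← trivializationAt_snd_eq_mvfderiv_extChartAt (mem_chart_source H' q),
    Trivialization.symmL_apply _ hq, Trivialization.symm_apply_apply_mk _ hq]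

lemma mvfderiv_extChartAt_extend {q p : N} (hp : p ∈ (chartAt H' q).source)
    (u : TangentSpace J q) :
    d% (extChartAt J q) p (FiberBundle.extend E' u p) = d% (extChartAt J q) q u := by
  have hp' : p ∈ (trivializationAt E' (TangentSpace J : N → Type _) q).baseSet := by simpa using hp
  rw [← trivializationAt_snd_eq_mvfderiv_extChartAt hp,
    ← trivializationAt_snd_eq_mvfderiv_extChartAt (mem_chart_source H' q), extend_eq _ hp',
    Trivialization.symmL_apply _ hp', Trivialization.apply_mk_symm _ hp']

lemma mlieBracket_extend [CompleteSpace E'] {q : N} (v w : TangentSpace J q) :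
    mlieBracket J (FiberBundle.extend E' v) (FiberBundle.extend E' w) q = 0 := by
  have mvfderiv_eq_zero (u : TangentSpace J q) :
      d% (fun p => d% (extChartAt J q) p (FiberBundle.extend E' u p)) q = 0 := by
    let c : E' := d% (extChartAt J q) q u
    have heq : (fun p => d% (extChartAt J q) p (FiberBundle.extend E' u p)) =ᶠ[nhds q]
        fun _ => c := by
      filter_upwards [(chartAt H' q).open_source.mem_nhds (mem_chart_source H' q)] with p hp
      exact mvfderiv_extChartAt_extend hp u
    exact (Filter.EventuallyEq.mfderiv_eq heq).trans (mvfderiv_const c)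
  rw [← symmL_mvfderiv_extChartAt (mlieBracket ..),
    mvfderiv_mlieBracket contMDiffAt_extChartAt (FiberBundle.mdifferentiableAt_extend ..)
      (FiberBundle.mdifferentiableAt_extend ..), mvfderiv_eq_zero, mvfderiv_eq_zero,
    zero_apply, zero_apply, sub_zero, map_zero]

variable {E : Type*} [NormedAddCommGroup E] [NormedSpace ℝ E]
  {H : Type*} [TopologicalSpace H] {I : ModelWithCorners ℝ E H}
  {M : Type*} [TopologicalSpace M] [ChartedSpace H M]
  {F : M → N} {x : M} {X Y : Π x : M, TangentSpace I x}
  {cov : CovariantDerivative J E' (TangentSpace J : N → Type _)}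

lemma pullbackCov_mfderiv_apply (hF : MDifferentiable I J F) (v : TangentSpace I x) :
    pullbackCov I cov F (fun y => mfderiv I J F y (Y y)) x v =
      (trivializationAt E' (TangentSpace J : N → Type _) (F x)).symmL ℝ (F x)
        (d% (fun y => d% (extChartAt J (F x) ∘ F) y (Y y)) x v) +
      cov (FiberBundle.extend E' (mfderiv I J F x (Y x))) (F x) (mfderiv I J F x v) := by
  have hcoord : (fun y => (trivializationAt E' (TangentSpace J : N → Type _) (F x)
        ⟨F y, mfderiv I J F y (Y y)⟩).2) =ᶠ[nhds x]
      fun y => d% (extChartAt J (F x) ∘ F) y (Y y) := by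
    filter_upwards [(hF x).continuousAt ((chartAt H' (F x)).open_source.mem_nhds
      (mem_chart_source H' (F x)))] with y hy
    rw [trivializationAt_snd_eq_mvfderiv_extChartAt hy]
    exact (congrArg (fun T => T (Y y)) <|
      mfderiv_comp y (mdifferentiableAt_extChartAt (I := J) hy) (hF y)).symm
  simp only [pullbackCov, add_apply, ContinuousLinearMap.comp_apply]
  congr 3
  exact hcoord.mfderiv_eq

theorem pullbackCov_mfderiv_sub_pullbackCov_mfderiv [FiniteDimensional ℝ E']
    [CompleteSpace E] [IsManifold I 2 M]
    (hF : ContMDiff I J 2 F) (hX : MDiffAt (T% X) x) (hY : MDiffAt (T% Y) x) :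
    pullbackCov I cov F (fun y => mfderiv I J F y (Y y)) x (X x) -
      pullbackCov I cov F (fun y => mfderiv I J F y (X y)) x (Y x) =
    mfderiv I J F x (mlieBracket I X Y x) +
      cov.torsion (F x) (mfderiv I J F x (X x)) (mfderiv I J F x (Y x)) := by
  have hFd : MDifferentiable I J F := hF.mdifferentiable two_ne_zero
  have mfderiv_mlieBracket_eq : mfderiv I J F x (mlieBracket I X Y x) =
      (trivializationAt E' (TangentSpace J : N → Type _) (F x)).symmL ℝ (F x)
        (d% (extChartAt J (F x) ∘ F) x (mlieBracket I X Y x)) := by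
    refine (symmL_mvfderiv_extChartAt _).symm.trans ?_
    congr 1
    exact (congrArg (fun T => T (mlieBracket I X Y x)) <|
      mfderiv_comp x (mdifferentiableAt_extChartAt (mem_chart_source H' (F x))) (hFd x)).symm
  rw [pullbackCov_mfderiv_apply hFd, pullbackCov_mfderiv_apply hFd, mfderiv_mlieBracket_eq,
    mvfderiv_mlieBracket (contMDiffAt_extChartAt.comp x (hF x)) hX hY,
    CovariantDerivative.torsion_apply_eq_extend, mlieBracket_extend,
    FiberBundle.extend_apply_self, FiberBundle.extend_apply_self, map_sub, sub_zero]
  abel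

end PullbackTorsion

section PullbackMetric

variable {E : Type*} [NormedAddCommGroup E] [NormedSpace ℝ E]
  {H : Type*} [TopologicalSpace H] {I : ModelWithCorners ℝ E H}
  {M : Type*} [TopologicalSpace M] [ChartedSpace H M]
  {E' : Type*} [NormedAddCommGroup E'] [NormedSpace ℝ E']
  {H' : Type*} [TopologicalSpace H'] {J : ModelWithCorners ℝ E' H'}
  {N : Type*} [TopologicalSpace N] [ChartedSpace H' N] [IsManifold J ∞ N]
  {F : M → N} {x : M}

variable (I J F) in
/-- Differentiability at `x` of a vector field `s` along `F`, i.e. of a section of `F⁻¹(TN)`. It is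
expressed through the associated map from `M` to the total space of `TN`. -/
abbrev MDifferentiableAlongAt (s : Π x : M, TangentSpace J (F x)) (x : M) : Prop :=
  MDifferentiableAt I J.tangent (fun y => (⟨F y, s y⟩ : TangentBundle J N)) x

variable {s t : Π x : M, TangentSpace J (F x)}

lemma MDifferentiableAlongAt.add (hs : MDifferentiableAlongAt I J F s x)
    (ht : MDifferentiableAlongAt I J F t x) :
    MDifferentiableAlongAt I J F (fun y => s y + t y) x := by
  obtain ⟨hF, hs⟩ := mdiff_coord hs
  let e := trivializationAt E' (TangentSpace J : N → Type _) (F x)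
  refine (mdifferentiableAt_totalSpace J (E := (TangentSpace J : N → Type _)) _).2 ⟨hF, ?_⟩
  refine (hs.add (mdiff_coord ht).2).congr_of_eventuallyEq ?_
  filter_upwards [hF.continuousAt (e.open_baseSet.mem_nhds
    (FiberBundle.mem_baseSet_trivializationAt' (F x)))] with y hy
  exact (e.linear ℝ hy).map_add _ _

lemma MDifferentiableAlongAt.smul {f : M → ℝ} (hf : MDiffAt f x)
    (hs : MDifferentiableAlongAt I J F s x) :
    MDifferentiableAlongAt I J F (fun y => f y • s y) x := by
  obtain ⟨hF, hs⟩ := mdiff_coord hs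
  let e := trivializationAt E' (TangentSpace J : N → Type _) (F x)
  refine (mdifferentiableAt_totalSpace J (E := (TangentSpace J : N → Type _)) _).2 ⟨hF, ?_⟩
  refine (hf.smul hs).congr_of_eventuallyEq ?_
  filter_upwards [hF.continuousAt (e.open_baseSet.mem_nhds
    (FiberBundle.mem_baseSet_trivializationAt' (F x)))] with y hy
  exact (e.linear ℝ hy).map_smul _ _

lemma MDifferentiableAlongAt.exists_eventually_eq_sum_smul [FiniteDimensional ℝ E']
    (hs : MDifferentiableAlongAt I J F s x) :
    ∃ (f : Fin (Module.finrank ℝ E') → M → ℝ)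
      (σ : Fin (Module.finrank ℝ E') → Π q : N, TangentSpace J q),
      (∀ i, MDiffAt (f i) x) ∧ (∀ i, MDiffAt (T% (σ i)) (F x)) ∧
        ∀ᶠ y in nhds x, s y = ∑ i, f i y • σ i (F y) := by
  obtain ⟨hF, hcoord⟩ := mdiff_coord hs
  let e := trivializationAt E' (TangentSpace J : N → Type _) (F x)
  have hx : F x ∈ e.baseSet := FiberBundle.mem_baseSet_trivializationAt' (F x)
  let b := Module.finBasis ℝ E'
  refine ⟨fun i y => b.coord i (e ⟨F y, s y⟩).2,
    fun i => FiberBundle.extend E' (e.symmL ℝ (F x) (b i)),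
    fun i => (LinearMap.toContinuousLinearMap
      (b.coord i)).differentiableAt.mdifferentiableAt.comp x hcoord,
    fun i => FiberBundle.mdifferentiableAt_extend .., ?_⟩
  filter_upwards [hF.continuousAt (e.open_baseSet.mem_nhds hx)] with y hy
  have extend_symmL (w : E') :
      FiberBundle.extend E' (e.symmL ℝ (F x) w) (F y) = e.symmL ℝ (F y) w := by
    rw [extend_eq _ hy, Trivialization.symmL_apply _ hx, e.apply_mk_symm hx]
  simp only [extend_symmL, ← map_smul, ← map_sum, b.coord_apply, b.sum_repr]
  rw [Trivialization.symmL_apply _ hy, e.symm_apply_apply_mk hy]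

@[elab_as_elim]
theorem MDifferentiableAlongAt.induction_on [FiniteDimensional ℝ E']
    {P : (Π x : M, TangentSpace J (F x)) → Prop} (hs : MDifferentiableAlongAt I J F s x)
    (comp : ∀ Z : Π q : N, TangentSpace J q, MDiffAt (T% Z) (F x) → P fun y => Z (F y))
    (add : ∀ s t, MDifferentiableAlongAt I J F s x → MDifferentiableAlongAt I J F t x →
      P s → P t → P fun y => s y + t y)
    (smul : ∀ (f : M → ℝ) s, MDiffAt f x → MDifferentiableAlongAt I J F s x →
      P s → P fun y => f y • s y)
    (congr : ∀ s t, (∀ᶠ y in nhds x, s y = t y) → P t → P s) : P s := by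
  classical
  have hF := (mdiff_coord hs).1
  obtain ⟨f, σ, hf, hσ, heq⟩ := hs.exists_eventually_eq_sum_smul
  suffices h : ∀ u : Finset (Fin (Module.finrank ℝ E')),
      MDifferentiableAlongAt I J F (fun y => ∑ i ∈ u, f i y • σ i (F y)) x ∧
        P fun y => ∑ i ∈ u, f i y • σ i (F y) from congr _ _ heq (h Finset.univ).2
  intro u
  induction u using Finset.induction_on with
  | empty =>
    have hzero : MDiffAt (T% (0 : Π q : N, TangentSpace J q)) (F x) :=
      mdifferentiableAt_zeroSection ℝ (TangentSpace J : N → Type _)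
    simp only [Finset.sum_empty]
    exact ⟨hzero.comp x hF, comp 0 hzero⟩
  | insert i u hi ih =>
    simp only [Finset.sum_insert hi]
    have hσF : MDifferentiableAlongAt I J F (fun y => σ i (F y)) x := (hσ i).comp x hF
    have hfσ := hσF.smul (hf i)
    exact ⟨hfσ.add ih.1, add _ _ hfσ ih.1 (smul _ _ (hf i) hσF (comp _ (hσ i))) ih.2⟩

variable {cov : CovariantDerivative J E' (TangentSpace J : N → Type _)}

lemma pullbackCov_congr (h : ∀ᶠ y in nhds x, s y = t y) :
    pullbackCov I cov F s x = pullbackCov I cov F t x := by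
  have hcoord : mvfderiv I (fun y =>
        (trivializationAt E' (TangentSpace J : N → Type _) (F x) ⟨F y, s y⟩).2) x =
      mvfderiv I (fun y =>
        (trivializationAt E' (TangentSpace J : N → Type _) (F x) ⟨F y, t y⟩).2) x :=
    Filter.EventuallyEq.mfderiv_eq (h.mono fun y hy => by simp only [hy])
  simp only [pullbackCov]
  rw [h.self_of_nhds, hcoord]

lemma pullbackCov_zero [FiniteDimensional ℝ E'] (hF : MDiffAt F x) :
    pullbackCov I cov F (fun _ => 0) x = 0 := by
  ext v
  have h := pullbackCov_comp (cov := cov) (Z := 0) hF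
    (mdifferentiableAt_zeroSection ℝ (TangentSpace J : N → Type _)) v
  rwa [cov.zero] at h

variable [RiemannianBundle (fun q : N => TangentSpace J q)]
  [IsContMDiffRiemannianBundle J ∞ E' (fun q : N => TangentSpace J q)]

lemma MDifferentiableAlongAt.inner (hs : MDifferentiableAlongAt I J F s x)
    (ht : MDifferentiableAlongAt I J F t x) : MDiffAt (fun y => inner ℝ (s y) (t y)) x :=
  MDifferentiableAt.inner_bundle (E := fun q : N => TangentSpace J q) (b := F) hs ht

variable [FiniteDimensional ℝ E']

lemma mvfderiv_inner_of_forall_comp {v : TangentSpace I x}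
    (hs : MDifferentiableAlongAt I J F s x) (ht : MDifferentiableAlongAt I J F t x)
    (hcomp : ∀ Z : Π q : N, TangentSpace J q, MDiffAt (T% Z) (F x) →
      d% (fun y => inner ℝ (Z (F y)) (t y)) x v =
        inner ℝ (pullbackCov I cov F (fun y => Z (F y)) x v) (t x) +
          inner ℝ (Z (F x)) (pullbackCov I cov F t x v)) :
    d% (fun y => inner ℝ (s y) (t y)) x v =
      inner ℝ (pullbackCov I cov F s x v) (t x) + inner ℝ (s x) (pullbackCov I cov F t x v) := by
  refine hs.induction_on hcomp (fun s s' hs hs' ihs ihs' => ?_) (fun f s hf hs ihs => ?_)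
    fun s s' heq ihs' => ?_
  · have hadd : (fun y => inner ℝ (s y + s' y) (t y)) =
        (fun y => inner ℝ (s y) (t y)) + fun y => inner ℝ (s' y) (t y) := by
      funext y; exact inner_add_left _ _ _
    rw [hadd, mvfderiv_add (hs.inner ht) (hs'.inner ht), pullbackCov_add hs hs', add_apply,
      add_apply, ihs, ihs', inner_add_left, inner_add_left]
    ring
  · have hsmul : (fun y => inner ℝ (f y • s y) (t y)) = f * fun y => inner ℝ (s y) (t y) := by
      funext y; exact real_inner_smul_left _ _ _
    rw [hsmul, mvfderiv_mul hf (hs.inner ht), pullbackCov_smul hf hs]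
    simp only [add_apply, smul_apply, ihs, inner_add_left, real_inner_smul_left, smul_eq_mul]
    ring
  · have hinner : d% (fun y => inner ℝ (s y) (t y)) x = d% (fun y => inner ℝ (s' y) (t y)) x :=
      Filter.EventuallyEq.mfderiv_eq (heq.mono fun y hy => by simp only [hy])
    rw [hinner, pullbackCov_congr heq, heq.self_of_nhds, ihs']

theorem mvfderiv_inner_eq_pullbackCov
    (hcov : ∀ (W Z : Π q : N, TangentSpace J q) (w : TangentSpace J (F x)),
      MDiffAt (T% W) (F x) → MDiffAt (T% Z) (F x) →
      d% (fun q => inner ℝ (W q) (Z q)) (F x) w =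
        inner ℝ (cov W (F x) w) (Z (F x)) + inner ℝ (W (F x)) (cov Z (F x) w))
    (hs : MDifferentiableAlongAt I J F s x) (ht : MDifferentiableAlongAt I J F t x)
    (v : TangentSpace I x) :
    d% (fun y => inner ℝ (s y) (t y)) x v =
      inner ℝ (pullbackCov I cov F s x v) (t x) + inner ℝ (s x) (pullbackCov I cov F t x v) := by
  have hF := (mdiff_coord hs).1
  refine mvfderiv_inner_of_forall_comp hs ht fun Z hZ => ?_
  have hZF : MDifferentiableAlongAt I J F (fun y => Z (F y)) x := hZ.comp x hF
  have swapped := mvfderiv_inner_of_forall_comp (cov := cov) (v := v) ht hZF fun W hW => by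
    rw [pullbackCov_comp hF hZ, pullbackCov_comp hF hW, ← hcov W Z _ hW hZ]
    exact congrArg (fun T => T v) (mfderiv_comp x (mdiff_ip hW hZ) hF)
  simp_rw [real_inner_comm (t _)]
  rw [swapped, add_comm, real_inner_comm _ (Z (F x))]

end PullbackMetric

section SecondFundamentalForm

variable {E : Type*} [NormedAddCommGroup E] [NormedSpace ℝ E] [FiniteDimensional ℝ E]
  {H : Type*} [TopologicalSpace H] {I : ModelWithCorners ℝ E H}
  {M : Type*} [TopologicalSpace M] [ChartedSpace H M] [IsManifold I ∞ M]
  [RiemannianBundle (fun x : M => TangentSpace I x)]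
  [IsContMDiffRiemannianBundle I ∞ E (fun x : M => TangentSpace I x)]
  {X X' Y Z : Π x : M, TangentSpace I x}

lemma mvfderiv_inner_eq_leviCivita {x : M} (hY : MDiffAt (T% Y) x) (hZ : MDiffAt (T% Z) x)
    (v : TangentSpace I x) :
    d% (fun y => inner ℝ (Y y) (Z y)) x v =
      inner ℝ (leviCivita I M Y x v) (Z x) + inner ℝ (Y x) (leviCivita I M Z x v) := by
  have h := leviCivita_metric (FiberBundle.mdifferentiableAt_extend I E v) hY hZ
  rwa [FiberBundle.extend_apply_self] at h

variable {E' : Type*} [NormedAddCommGroup E'] [NormedSpace ℝ E'] [FiniteDimensional ℝ E']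
  {H' : Type*} [TopologicalSpace H'] {J : ModelWithCorners ℝ E' H'}
  {N : Type*} [TopologicalSpace N] [ChartedSpace H' N] [IsManifold J ∞ N]
  [RiemannianBundle (fun q : N => TangentSpace J q)]
  [IsContMDiffRiemannianBundle J ∞ E' (fun q : N => TangentSpace J q)]
  {F : M → N}

variable (X Y) in
lemma secondFundamentalForm_add_left (x : M) :
    secondFundamentalForm I J F (fun y => X y + X' y) Y x =
      secondFundamentalForm I J F X Y x + secondFundamentalForm I J F X' Y x := by
  simp only [secondFundamentalForm, nabla, map_add]
  abel

theorem secondFundamentalForm_symm (hF : ContMDiff I J 2 F) {x : M}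
    (hX : MDiffAt (T% X) x) (hY : MDiffAt (T% Y) x) :
    secondFundamentalForm I J F X Y x = secondFundamentalForm I J F Y X x := by
  have torsion_eq_zero : (leviCivita J N).torsion = 0 :=
    (leviCivita J N).torsion_eq_zero_iff.2 leviCivita_torsion
  have hpull := pullbackCov_mfderiv_sub_pullbackCov_mfderiv (cov := leviCivita J N) hF hX hY
  rw [torsion_eq_zero, ← leviCivita_torsion hX hY, map_sub] at hpull
  simp only [Pi.zero_apply, zero_apply, add_zero] at hpull
  simp only [secondFundamentalForm, nabla]
  rw [sub_eq_sub_iff_sub_eq_sub, hpull]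

lemma secondFundamentalForm_eq_neg_mfderiv_nabla {x : M} (hF : MDiffAt F x)
    (hY : ∀ x, Y x ∈ vertical I J F x) :
    secondFundamentalForm I J F X Y x = -mfderiv I J F x (nabla I X Y x) := by
  have mfderiv_eq_zero (y : M) : mfderiv I J F y (Y y) = 0 := mem_vertical.1 (hY y)
  simp only [secondFundamentalForm, mfderiv_eq_zero]
  rw [pullbackCov_zero hF, zero_apply, zero_sub]

namespace IsRiemannianSubmersion

theorem inner_secondFundamentalForm_swap
    (hF : IsRiemannianSubmersion I J F) (X : Π x : M, TangentSpace I x)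
    (hY : IsHorizontalField I J F Y) (hZ : IsHorizontalField I J F Z) (x : M) :
    inner ℝ (secondFundamentalForm I J F X Y x) (mfderiv I J F x (Z x)) =
      -inner ℝ (secondFundamentalForm I J F X Z x) (mfderiv I J F x (Y x)) := by
  have mdifferentiableAlongAt_mfderiv {W : Π x : M, TangentSpace I x}
      (hW : IsHorizontalField I J F W) :
      MDifferentiableAlongAt I J F (fun y => mfderiv I J F y (W y)) x :=
    ((hF.contMDiff.contMDiff_tangentMap (m := ∞) (by simp)).comp hW.1).mdifferentiable (by simp) x
  have hM := mvfderiv_inner_eq_leviCivita (hY.1.mdifferentiable (by simp) x)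
    (hZ.1.mdifferentiable (by simp) x) (X x)
  have hN := mvfderiv_inner_eq_pullbackCov
    (fun W Z w hW hZ => mvfderiv_inner_eq_leviCivita hW hZ w)
    (mdifferentiableAlongAt_mfderiv hY) (mdifferentiableAlongAt_mfderiv hZ) (X x)
  simp only [hF.inner_mfderiv (hY.2 _)] at hN
  simp only [secondFundamentalForm, nabla, inner_sub_left]
  rw [real_inner_comm _ (mfderiv I J F x (leviCivita I M Y x (X x))), hF.inner_mfderiv (hZ.2 x),
    real_inner_comm _ (mfderiv I J F x (leviCivita I M Z x (X x))), hF.inner_mfderiv (hY.2 x),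
    real_inner_comm (leviCivita I M Y x (X x))]
  rw [real_inner_comm _ (mfderiv I J F x (Y x))] at hN
  linarith

variable [T2Space M]

theorem secondFundamentalForm_eq_zero (hF : IsRiemannianSubmersion I J F)
    (hX : IsHorizontalField I J F X) (hY : IsHorizontalField I J F Y) (x : M) :
    secondFundamentalForm I J F X Y x = 0 := by
  refine ext_inner_right ℝ fun w => ?_
  obtain ⟨z, rfl⟩ := hF.surjective_mfderiv x w
  obtain ⟨Z', hZ', rfl⟩ := exists_contMDiff_section_eq (IB := I) (F := E) x z
  rw [← mfderiv_horPart, inner_zero_left]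
  have hZ : IsHorizontalField I J F (horPart I J F Z') := hF.isHorizontalField_horPart hZ'
  have symm {A B : Π x : M, TangentSpace I x} (hA : IsHorizontalField I J F A)
      (hB : IsHorizontalField I J F B) :=
    secondFundamentalForm_symm (hF.contMDiff.of_le ENat.LEInfty.out)
      (hA.1.mdifferentiable (by simp) x) (hB.1.mdifferentiable (by simp) x)
  have hXYZ := hF.inner_secondFundamentalForm_swap X hY hZ x
  have hZXY := hF.inner_secondFundamentalForm_swap (horPart I J F Z') hX hY x
  have hYZX := hF.inner_secondFundamentalForm_swap Y hZ hX x
  rw [symm hX hZ] at hXYZ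
  rw [symm hZ hY] at hZXY
  rw [symm hY hX] at hYZX
  linarith

end IsRiemannianSubmersion

end SecondFundamentalForm

section TotallyGeodesic

variable {E : Type*} [NormedAddCommGroup E] [NormedSpace ℝ E] [FiniteDimensional ℝ E]
  {H : Type*} [TopologicalSpace H] {I : ModelWithCorners ℝ E H}
  {M : Type*} [TopologicalSpace M] [ChartedSpace H M] [IsManifold I ∞ M]
  [RiemannianBundle (fun x : M => TangentSpace I x)]
  [IsContMDiffRiemannianBundle I ∞ E (fun x : M => TangentSpace I x)]
  {E' : Type*} [NormedAddCommGroup E'] [NormedSpace ℝ E'] [FiniteDimensional ℝ E']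
  {H' : Type*} [TopologicalSpace H'] {J : ModelWithCorners ℝ E' H'}
  {N : Type*} [TopologicalSpace N] [ChartedSpace H' N] [IsManifold J ∞ N]
  [RiemannianBundle (fun q : N => TangentSpace J q)]
  [IsContMDiffRiemannianBundle J ∞ E' (fun q : N => TangentSpace J q)]
  {F : M → N} {X Y U : Π x : M, TangentSpace I x} {x : M}

lemma secondFundamentalForm_eq_zero_iff (hF : MDiffAt F x) (hU : ∀ x, U x ∈ vertical I J F x) :
    secondFundamentalForm I J F X U x = 0 ↔ nabla I X U x ∈ vertical I J F x := by
  rw [secondFundamentalForm_eq_neg_mfderiv_nabla hF hU, neg_eq_zero, mem_vertical]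

variable (X Y x) in
lemma secondFundamentalForm_eq_verPart_add_horPart :
    secondFundamentalForm I J F X Y x =
      secondFundamentalForm I J F (verPart I J F X) Y x +
        secondFundamentalForm I J F (horPart I J F X) Y x := by
  simp only [← secondFundamentalForm_add_left, verPart_add_horPart]

theorem IsRiemannianSubmersion.isTotallyGeodesic_iff [T2Space M]
    (hF : IsRiemannianSubmersion I J F) :
    IsTotallyGeodesic I J F ↔
      (∀ W, IsVerticalField I J F W → ∀ U, IsVerticalField I J F U →
        ∀ x, nabla I W U x ∈ vertical I J F x) ∧
      (∀ X, IsHorizontalField I J F X → ∀ U, IsVerticalField I J F U →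
        ∀ x, nabla I X U x ∈ vertical I J F x) := by
  have eq_zero_iff (X : Π x : M, TangentSpace I x) {U : Π x : M, TangentSpace I x}
      (hU : IsVerticalField I J F U) (x : M) :=
    secondFundamentalForm_eq_zero_iff (X := X)
      (hF.contMDiff.mdifferentiable (by simp) x) hU.2
  refine ⟨fun h => ⟨fun W hW U hU x => (eq_zero_iff W hU x).1 (h W U hW.1 hU.1 x),
    fun X hX U hU x => (eq_zero_iff X hU x).1 (h X U hX.1 hU.1 x)⟩, ?_⟩
  rintro ⟨nabla_ver, nabla_hor⟩ X Y hX hY x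
  have symm {A B : Π x : M, TangentSpace I x} (hA : ContMDiff I I.tangent ∞ (T% A))
      (hB : ContMDiff I I.tangent ∞ (T% B)) :=
    secondFundamentalForm_symm (hF.contMDiff.of_le ENat.LEInfty.out)
      (hA.mdifferentiable (by simp) x) (hB.mdifferentiable (by simp) x)
  have eq_zero_of_vertical {A U : Π x : M, TangentSpace I x}
      (hA : ContMDiff I I.tangent ∞ (T% A)) (hU : IsVerticalField I J F U) :
      secondFundamentalForm I J F A U x = 0 := by
    rw [secondFundamentalForm_eq_verPart_add_horPart,
      (eq_zero_iff _ hU x).2 (nabla_ver _ (hF.isVerticalField_verPart hA) U hU x),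
      (eq_zero_iff _ hU x).2 (nabla_hor _ (hF.isHorizontalField_horPart hA) U hU x), add_zero]
  have hXv := hF.isVerticalField_verPart hX
  have hXh := hF.isHorizontalField_horPart hX
  have hYv := hF.isVerticalField_verPart hY
  have hYh := hF.isHorizontalField_horPart hY
  rw [secondFundamentalForm_eq_verPart_add_horPart, symm hXv.1 hY, eq_zero_of_vertical hY hXv,
    symm hXh.1 hY, secondFundamentalForm_eq_verPart_add_horPart, symm hYv.1 hXh.1,
    eq_zero_of_vertical hXh.1 hYv, hF.secondFundamentalForm_eq_zero hYh hXh, add_zero, add_zero]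

end TotallyGeodesic

section Cosymplectic

variable {E : Type*} [NormedAddCommGroup E] [NormedSpace ℝ E]
  {H : Type*} [TopologicalSpace H] {I : ModelWithCorners ℝ E H}
  {M : Type*} [TopologicalSpace M] [ChartedSpace H M] [IsManifold I ∞ M]
  {X Z : Π x : M, TangentSpace I x}

open VectorField

lemma contMDiff_endomorphism_apply {φ : Π x : M, TangentSpace I x →L[ℝ] TangentSpace I x}
    (hφ : ContMDiff I (I.prod 𝓘(ℝ, E →L[ℝ] E)) ∞ (fun x => TotalSpace.mk' (E →L[ℝ] E)
      (E := fun x : M => TangentSpace I x →L[ℝ] TangentSpace I x) x (φ x)))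
    (hX : ContMDiff I I.tangent ∞ (T% X)) :
    ContMDiff I I.tangent ∞ (T% (fun x => φ x (X x))) :=
  ContMDiff.clm_bundle_apply (E₁ := fun x : M => TangentSpace I x)
    (E₂ := fun x : M => TangentSpace I x) (b := id) hφ hX

variable [RiemannianBundle (fun x : M => TangentSpace I x)]

namespace AlmostContactMetricStructure

variable (S : AlmostContactMetricStructure I M)

lemma inner_phi (x : M) (v w : TangentSpace I x) :
    inner ℝ v (S.phi x w) = -inner ℝ (S.phi x v) w := by
  have h := S.inner_phi_phi x v (S.phi x w)
  rw [S.eta_phi, mul_zero, sub_zero, S.phi_phi, inner_add_right, inner_neg_right,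
    real_inner_smul_right, ← S.eta_eq_inner, S.eta_phi, mul_zero, add_zero] at h
  exact h.symm

lemma inner_xi_phi (x : M) (v : TangentSpace I x) : inner ℝ (S.xi x) (S.phi x v) = 0 := by
  rw [S.inner_phi, S.phi_xi, inner_zero_left, neg_zero]

lemma contMDiff_phi_apply (hX : ContMDiff I I.tangent ∞ (T% X)) :
    ContMDiff I I.tangent ∞ (T% (fun x => S.phi x (X x))) :=
  contMDiff_endomorphism_apply S.contMDiff_phi hX

variable {S}

lemma IsCosymplectic.eta_mlieBracket (hS : S.IsCosymplectic)
    (hX : ContMDiff I I.tangent ∞ (T% X)) (hZ : ContMDiff I I.tangent ∞ (T% Z)) (x : M) :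
    S.eta x (mlieBracket I X Z x) =
      d% (fun y => S.eta y (Z y)) x (X x) - d% (fun y => S.eta y (X y)) x (Z x) := by
  have h := hS.closed_eta X Z hX hZ x
  rw [extDerivOne] at h
  linarith

lemma IsCosymplectic.eta_mlieBracket_phi_xi (hS : S.IsCosymplectic)
    (hX : ContMDiff I I.tangent ∞ (T% X)) (x : M) :
    S.eta x (mlieBracket I (fun y => S.phi y (X y)) S.xi x) = 0 := by
  rw [hS.eta_mlieBracket (S.contMDiff_phi_apply hX) S.contMDiff_xi]
  simp [S.eta_xi, S.eta_phi, mvfderiv_const]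

theorem IsCosymplectic.phi_mlieBracket_xi (hS : S.IsCosymplectic)
    (hX : ContMDiff I I.tangent ∞ (T% X)) (x : M) :
    S.phi x (mlieBracket I X S.xi x) = mlieBracket I (fun y => S.phi y (X y)) S.xi x := by
  have hnormal := hS.normal X S.xi hX S.contMDiff_xi x
  have phi_xi_eq_zero : (fun y => S.phi y (S.xi y)) = (0 : Π x : M, TangentSpace I x) :=
    funext S.phi_xi
  rw [hS.closed_eta X S.xi hX S.contMDiff_xi x, mul_zero, zero_smul, add_zero, nijenhuis,
    phi_xi_eq_zero, mlieBracket_zero_right, mlieBracket_zero_right, Pi.zero_apply, map_zero,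
    add_zero, sub_zero, ← map_sub] at hnormal
  have phi_hnormal := congrArg (S.phi x) hnormal
  rw [S.phi_phi, map_zero, map_sub (S.eta x), S.eta_phi, hS.eta_mlieBracket_phi_xi hX, sub_zero,
    zero_smul, add_zero, neg_eq_zero] at phi_hnormal
  exact sub_eq_zero.1 phi_hnormal

-- `L_ξ Φ = 0` by Cartan's formula; together with `L_ξ φ = 0` this says `(L_ξ g)(X, φ Z) = 0`.
theorem IsCosymplectic.mvfderiv_inner_phi_xi (hS : S.IsCosymplectic)
    (hX : ContMDiff I I.tangent ∞ (T% X)) (hZ : ContMDiff I I.tangent ∞ (T% Z)) (x : M) :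
    d% (fun y => inner ℝ (X y) (S.phi y (Z y))) x (S.xi x) =
      inner ℝ (mlieBracket I S.xi X x) (S.phi x (Z x)) +
        inner ℝ (X x) (mlieBracket I S.xi (fun y => S.phi y (Z y)) x) := by
  have hclosed := hS.closed_fundamentalForm S.xi X Z S.contMDiff_xi hX hZ x
  simp only [extDerivTwo, fundamentalForm, S.phi_xi, inner_xi_phi, inner_zero_right,
    mvfderiv_const, zero_apply] at hclosed
  rw [S.inner_phi x (mlieBracket I Z S.xi x), hS.phi_mlieBracket_xi hZ,
    mlieBracket_swap_apply (W := S.xi), inner_neg_left, real_inner_comm (X x)] at hclosed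
  linarith

variable [FiniteDimensional ℝ E]
  [IsContMDiffRiemannianBundle I ∞ E (fun x : M => TangentSpace I x)]

variable (S) in
theorem inner_leviCivita_xi_xi (x : M) (v : TangentSpace I x) :
    inner ℝ (leviCivita I M S.xi x v) (S.xi x) = 0 := by
  have hξ := S.contMDiff_xi.mdifferentiable (by simp) x
  have hmetric := mvfderiv_inner_eq_leviCivita hξ hξ v
  simp only [← S.eta_eq_inner, S.eta_xi, mvfderiv_const, zero_apply] at hmetric
  rw [real_inner_comm, ← S.eta_eq_inner] at hmetric
  rw [← S.eta_eq_inner]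
  linarith

theorem IsCosymplectic.inner_leviCivita_xi_comm (hS : S.IsCosymplectic)
    (hX : ContMDiff I I.tangent ∞ (T% X)) (hZ : ContMDiff I I.tangent ∞ (T% Z)) (x : M) :
    inner ℝ (leviCivita I M S.xi x (X x)) (Z x) =
      inner ℝ (leviCivita I M S.xi x (Z x)) (X x) := by
  have hX' := hX.mdifferentiable (by simp) x
  have hZ' := hZ.mdifferentiable (by simp) x
  have hξ := S.contMDiff_xi.mdifferentiable (by simp) x
  have hη := hS.eta_mlieBracket hX hZ x
  simp only [S.eta_eq_inner] at hη
  rw [mvfderiv_inner_eq_leviCivita hX' hξ, mvfderiv_inner_eq_leviCivita hZ' hξ,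
    ← leviCivita_torsion hX' hZ', inner_sub_left] at hη
  rw [real_inner_comm (Z x), real_inner_comm (X x)]
  linarith

theorem IsCosymplectic.inner_leviCivita_xi_phi (hS : S.IsCosymplectic)
    (hX : ContMDiff I I.tangent ∞ (T% X)) (hZ : ContMDiff I I.tangent ∞ (T% Z)) (x : M) :
    inner ℝ (leviCivita I M S.xi x (X x)) (S.phi x (Z x)) = 0 := by
  have hφZ := S.contMDiff_phi_apply hZ
  have hX' := hX.mdifferentiable (by simp) x
  have hφZ' := hφZ.mdifferentiable (by simp) x
  have hξ := S.contMDiff_xi.mdifferentiable (by simp) x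
  have hcomm := hS.inner_leviCivita_xi_comm hX hφZ x
  have hkilling := hS.mvfderiv_inner_phi_xi hX hZ x
  rw [mvfderiv_inner_eq_leviCivita hX' hφZ', ← leviCivita_torsion hξ hX',
    ← leviCivita_torsion hξ hφZ', inner_sub_left, inner_sub_right,
    real_inner_comm (leviCivita I M S.xi x (S.phi x (Z x)))] at hkilling
  linarith

theorem IsCosymplectic.leviCivita_xi [T2Space M] (hS : S.IsCosymplectic) :
    leviCivita I M S.xi = 0 := by
  ext x v
  refine ext_inner_right ℝ fun w => ?_
  obtain ⟨X, hX, rfl⟩ := exists_contMDiff_section_eq (IB := I) (F := E) x v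
  obtain ⟨Z, hZ, hZw⟩ := exists_contMDiff_section_eq (IB := I) (F := E) x (S.phi x w)
  have w_eq : w = S.eta x w • S.xi x - S.phi x (Z x) := by
    rw [hZw, S.phi_phi]
    abel
  rw [w_eq, inner_sub_right, real_inner_smul_right, S.inner_leviCivita_xi_xi,
    hS.inner_leviCivita_xi_phi hX hZ, mul_zero, sub_zero]
  simp

end AlmostContactMetricStructure

end Cosymplectic

section ONeill

variable {E : Type*} [NormedAddCommGroup E] [NormedSpace ℝ E] [FiniteDimensional ℝ E]
  {H : Type*} [TopologicalSpace H] {I : ModelWithCorners ℝ E H}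
  {M : Type*} [TopologicalSpace M] [ChartedSpace H M]
  [RiemannianBundle (fun x : M => TangentSpace I x)]
  {E' : Type*} [NormedAddCommGroup E'] [NormedSpace ℝ E']
  {H' : Type*} [TopologicalSpace H'] {J : ModelWithCorners ℝ E' H'}
  {N : Type*} [TopologicalSpace N] [ChartedSpace H' N]
  {F : M → N} {X Y U V : Π x : M, TangentSpace I x}

lemma verPart_eq_self (hV : ∀ x, V x ∈ vertical I J F x) : verPart I J F V = V :=
  funext fun x => Submodule.starProjection_eq_self_iff.2 (hV x)

lemma horPart_eq_self (hY : ∀ x, Y x ∈ (vertical I J F x)ᗮ) : horPart I J F Y = Y :=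
  funext fun x => Submodule.starProjection_eq_self_iff.2 (hY x)

lemma verPart_eq_zero_iff {x : M} :
    verPart I J F Y x = 0 ↔ Y x ∈ (vertical I J F x)ᗮ :=
  Submodule.starProjection_apply_eq_zero_iff _

lemma horPart_zero : horPart I J F (0 : Π x : M, TangentSpace I x) = 0 :=
  funext fun _ => map_zero _

variable [IsManifold I ∞ M] [IsContMDiffRiemannianBundle I ∞ E (fun x : M => TangentSpace I x)]

lemma nabla_zero : nabla I X 0 = 0 := by
  funext x
  rw [nabla, (leviCivita I M).zero]
  rfl

lemma tensorT_of_vertical_of_horizontal (hV : ∀ x, V x ∈ vertical I J F x)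
    (hY : ∀ x, Y x ∈ (vertical I J F x)ᗮ) :
    tensorT I J F V Y = verPart I J F (nabla I V Y) := by
  have verPart_eq_zero : verPart I J F Y = 0 := funext fun x => verPart_eq_zero_iff.2 (hY x)
  funext x
  rw [tensorT, verPart_eq_self hV, horPart_eq_self hY, verPart_eq_zero, nabla_zero, horPart_zero,
    Pi.zero_apply, zero_add]

lemma tensorA_of_horizontal_of_horizontal (hX : ∀ x, X x ∈ (vertical I J F x)ᗮ)
    (hY : ∀ x, Y x ∈ (vertical I J F x)ᗮ) :
    tensorA I J F X Y = verPart I J F (nabla I X Y) := by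
  have verPart_eq_zero : verPart I J F Y = 0 := funext fun x => verPart_eq_zero_iff.2 (hY x)
  funext x
  rw [tensorA, horPart_eq_self hX, horPart_eq_self hY, verPart_eq_zero, nabla_zero, horPart_zero,
    Pi.zero_apply, add_zero]

variable (X) in
lemma inner_nabla_eq_neg_inner_nabla (hY : IsHorizontalField I J F Y) (hU : IsVerticalField I J F U)
    (x : M) : inner ℝ (Y x) (nabla I X U x) = -inner ℝ (nabla I X Y x) (U x) := by
  have h := mvfderiv_inner_eq_leviCivita (hY.1.mdifferentiable (by simp) x)
    (hU.1.mdifferentiable (by simp) x) (X x)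
  have inner_eq_zero (y : M) : inner ℝ (Y y) (U y) = 0 :=
    (Submodule.mem_orthogonal' _ _).1 (hY.2 y) _ (hU.2 y)
  simp only [inner_eq_zero, mvfderiv_const, zero_apply] at h
  simp only [nabla]
  linarith

variable [IsManifold J ∞ N] [RiemannianBundle (fun q : N => TangentSpace J q)]
  [IsContMDiffRiemannianBundle J ∞ E' (fun q : N => TangentSpace J q)]
  {φ : Π x : M, TangentSpace I x →L[ℝ] TangentSpace I x} {ξ : Π x : M, TangentSpace I x}

variable (X) in
theorem IsRiemannianSubmersion.forall_nabla_mem_vertical_iff [T2Space M]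
    (hF : IsRiemannianSubmersion I J F)
    (hφ : ∀ V, IsVerticalField I J F V → IsHorizontalField I J F (fun y => φ y (V y)))
    (hξ : IsHorizontalField I J F ξ) (parallel : leviCivita I M ξ = 0)
    (hle : ∀ x, (vertical I J F x)ᗮ ≤
      (vertical I J F x).map (φ x : TangentSpace I x →ₗ[ℝ] TangentSpace I x) ⊔
        Submodule.span ℝ {ξ x}) :
    (∀ U, IsVerticalField I J F U → ∀ x, nabla I X U x ∈ vertical I J F x) ↔
      ∀ V, IsVerticalField I J F V →
        ∀ x, verPart I J F (nabla I X (fun y => φ y (V y))) x = 0 := by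
  refine ⟨fun h V hV x => verPart_eq_zero_iff.2 ((Submodule.mem_orthogonal' _ _).2 fun u hu => ?_),
    fun h U hU x => ?_⟩
  · obtain ⟨U, hU, rfl⟩ := hF.exists_isVerticalField_eq hu
    rw [← neg_eq_zero, ← inner_nabla_eq_neg_inner_nabla X (hφ V hV) hU]
    exact (Submodule.mem_orthogonal' _ _).1 ((hφ V hV).2 x) _ (h U hU x)
  · rw [← (vertical I J F x).orthogonal_orthogonal, Submodule.mem_orthogonal]
    intro w hw
    obtain ⟨_, ⟨v, hv, rfl⟩, _, hc, rfl⟩ := Submodule.mem_sup.1 (hle x hw)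
    obtain ⟨c, rfl⟩ := Submodule.mem_span_singleton.1 hc
    obtain ⟨V, hV, rfl⟩ := hF.exists_isVerticalField_eq hv
    have inner_phi : inner ℝ (φ x (V x)) (nabla I X U x) = 0 := by
      rw [inner_nabla_eq_neg_inner_nabla X (hφ V hV) hU, neg_eq_zero]
      exact (Submodule.mem_orthogonal' _ _).1 (verPart_eq_zero_iff.1 (h V hV x)) _ (hU.2 x)
    have inner_xi : inner ℝ (ξ x) (nabla I X U x) = 0 := by
      rw [inner_nabla_eq_neg_inner_nabla X hξ hU, nabla, parallel]
      simp
    rw [inner_add_left, real_inner_smul_left, inner_xi, mul_zero, add_zero]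
    exact inner_phi

end ONeill

end CosymplecticSubmersion

theorem theorem15_general
    {E : Type*} [NormedAddCommGroup E] [NormedSpace ℝ E] [FiniteDimensional ℝ E]
    {H : Type*} [TopologicalSpace H] {I : ModelWithCorners ℝ E H}
    {M : Type*} [TopologicalSpace M] [T2Space M] [ChartedSpace H M] [IsManifold I ∞ M]
    [RiemannianBundle (fun x : M => TangentSpace I x)]
    [IsContMDiffRiemannianBundle I ∞ E (fun x : M => TangentSpace I x)]
    {E' : Type*} [NormedAddCommGroup E'] [NormedSpace ℝ E'] [FiniteDimensional ℝ E']
    {H' : Type*} [TopologicalSpace H'] {J : ModelWithCorners ℝ E' H'}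
    {N : Type*} [TopologicalSpace N] [ChartedSpace H' N] [IsManifold J ∞ N]
    [RiemannianBundle (fun q : N => TangentSpace J q)]
    [IsContMDiffRiemannianBundle J ∞ E' (fun q : N => TangentSpace J q)]
    {φ : Π x : M, TangentSpace I x →L[ℝ] TangentSpace I x}
    (hφ : ContMDiff I (I.prod 𝓘(ℝ, E →L[ℝ] E)) ∞ (fun x => TotalSpace.mk' (E →L[ℝ] E)
      (E := fun x : M => TangentSpace I x →L[ℝ] TangentSpace I x) x (φ x)))
    {ξ : Π x : M, TangentSpace I x} (hξ : ContMDiff I I.tangent ∞ (T% ξ))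
    (parallel : leviCivita I M ξ = 0)
    {F : M → N} (hF : IsRiemannianSubmersion I J F)
    (hsum : ∀ x : M, (vertical I J F x)ᗮ =
      (vertical I J F x).map (φ x : TangentSpace I x →ₗ[ℝ] TangentSpace I x)
        ⊔ Submodule.span ℝ {ξ x}) :
    IsTotallyGeodesic I J F ↔
      (∀ W V : Π x : M, TangentSpace I x, IsVerticalField I J F W → IsVerticalField I J F V →
        ∀ x, tensorT I J F W (fun y => φ y (V y)) x = 0) ∧
      (∀ X W : Π x : M, TangentSpace I x, IsHorizontalField I J F X → IsVerticalField I J F W →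
        ∀ x, tensorA I J F X (fun y => φ y (W y)) x = 0) := by
  have hφV (V) (hV : IsVerticalField I J F V) : IsHorizontalField I J F (fun y => φ y (V y)) :=
    ⟨contMDiff_endomorphism_apply hφ hV.1, fun y =>
      hsum y ▸ Submodule.mem_sup_left (Submodule.mem_map_of_mem (hV.2 y))⟩
  have hξ' : IsHorizontalField I J F ξ := ⟨hξ, fun y =>
    hsum y ▸ Submodule.mem_sup_right (Submodule.mem_span_singleton_self _)⟩
  have nabla_iff (X : Π x : M, TangentSpace I x) :=
    hF.forall_nabla_mem_vertical_iff X hφV hξ' parallel fun x => (hsum x).le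
  simp only [hF.isTotallyGeodesic_iff, nabla_iff]
  refine and_congr (forall_congr' fun W => ?_) (forall_congr' fun X => ?_)
  · rw [← forall_comm]
    refine forall₃_congr fun V hW hV => ?_
    rw [tensorT_of_vertical_of_horizontal hW.2 (hφV V hV).2]
  · rw [← forall_comm]
    refine forall₃_congr fun V hX hV => ?_
    rw [tensorA_of_horizontal_of_horizontal hX.2 (hφV V hV).2]

theorem theorem15
    {E : Type*} [NormedAddCommGroup E] [NormedSpace ℝ E] [FiniteDimensional ℝ E]
    {H : Type*} [TopologicalSpace H] (I : ModelWithCorners ℝ E H) [I.Boundaryless]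
    {M : Type*} [TopologicalSpace M] [T2Space M] [ChartedSpace H M] [IsManifold I ∞ M]
    [RiemannianBundle (fun x : M => TangentSpace I x)]
    [IsContMDiffRiemannianBundle I ∞ E (fun x : M => TangentSpace I x)]
    {E' : Type*} [NormedAddCommGroup E'] [NormedSpace ℝ E'] [FiniteDimensional ℝ E']
    {H' : Type*} [TopologicalSpace H'] (J : ModelWithCorners ℝ E' H') [J.Boundaryless]
    {N : Type*} [TopologicalSpace N] [T2Space N] [ChartedSpace H' N] [IsManifold J ∞ N]
    [RiemannianBundle (fun q : N => TangentSpace J q)]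
    [IsContMDiffRiemannianBundle J ∞ E' (fun q : N => TangentSpace J q)]
    (S : AlmostContactMetricStructure I M) (hS : S.IsCosymplectic)
    (F : M → N) (hF : IsRiemannianSubmersion I J F) (hanti : IsAntiInvariant J S F)
    (hsum : ∀ x : M,
      (vertical I J F x)ᗮ =
          (vertical I J F x).map (S.phi x : TangentSpace I x →ₗ[ℝ] TangentSpace I x)
            ⊔ Submodule.span ℝ {S.xi x} ∧
        Disjoint ((vertical I J F x).map (S.phi x : TangentSpace I x →ₗ[ℝ] TangentSpace I x))
          (Submodule.span ℝ {S.xi x})) :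
    IsTotallyGeodesic I J F ↔
      (∀ W V : Π x : M, TangentSpace I x, IsVerticalField I J F W → IsVerticalField I J F V →
        ∀ x, tensorT I J F W (fun y => S.phi y (V y)) x = 0) ∧
      (∀ X W : Π x : M, TangentSpace I x, IsHorizontalField I J F X → IsVerticalField I J F W →
        ∀ x, tensorA I J F X (fun y => S.phi y (W y)) x = 0) :=
  theorem15_general S.contMDiff_phi S.contMDiff_xi hS.leviCivita_xi hF fun x => (hsum x).1
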